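/- Let $a,b\in\mathbb Q$ with $a\neq 0$, and suppose $$d:=-4b^3+(a^2-30a+1)b^2+2a(3a+1)(4a-7)b-a(4a^4-4a^3-40a^2+91a-4)\neq 0 .$$ Let $k=\mathbb Q(\sqrt d)$, with a fixed choice of $\sqrt d$ (the case $k=\mathbb Q$ is allowed), and let $\overline k$ be an algebraic closure of $k$. Consider the following elliptic curves over $\mathbb Q$: $$E_{a,b}:\ y^2=x^3+d(a^2-30a+1)x^2-8d^2a(3a+1)(4a-7)x-16d^3a(4a^4-4a^3-40a^2+91a-4),$$ $$E^*_{a,b}:\ y^2=x^3+(a^2-30a+1)dx^2-8(26a^4-310a^3+327a^2+315a+26)d^2x+16(68a^6-1120a^5+3804a^4+1760a^3+6929a^2+1380a+68)d^3,$$ $$E_a:\ y^2-(a-1)xy-ay=x^3-ax^2-5a(a^2+2a-1)x-a(a^4+10a^3-5a^2+15a-1),$$ $$E^*_a:\ y^2-(a-1)xy-ay=x^3-ax^2 .$$ The maps $$f:E_{a,b}\to E_a,\quad (x,y)\mapsto\Bigl(\tfrac{x}{4d}-2a,\ \tfrac{a-1}{8d}x+\tfrac{y}{8d\sqrt d}-\tfrac{a(2a-3)}2\Bigr),$$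 $$f^*:E^*_{a,b}\to E^*_a,\quad (x,y)\mapsto\Bigl(\tfrac{x}{100d}-\tfrac{2(a^2-5a+1)}{25},\ \tfrac{a-1}{200d}x+\tfrac{y}{1000d\sqrt d}-\tfrac{2a^3-12a^2-13a-2}{50}\Bigr)$$ are isomorphisms defined over $k$. Let $\lambda^*:E^*_a\to E_a$ be the isogeny over $\mathbb Q$ whose $x$-coordinate is $$X(x)=\frac{x^5-2ax^4+a(a^2+3a-1)x^3-3a^2(a-1)x^2+a^3(a-3)x+a^4}{x^2(x-a)^2}$$ and whose $y$-coordinate $Y$ is given by $2Y-(a-1)X-a=X'(x)\,(2y-(a-1)x-a)$. Let $\phi^*:E^*_{a,b}\to E_{a,b}$ be the isogeny over $\mathbb Q$ with $f\circ\phi^*=\lambda^*\circ f^*$; explicitly, with $\xi=\tfrac{x}{100d}-\tfrac{2(a^2-5a+1)}{25}$, it is $(x,y)\mapsto\bigl(4d(X(\xi)+2a),\ \tfrac{1}{125}\,y\,X'(\xi)\bigr)$. Then $f$ and $f^*$ are bijective group homomorphisms on $\overline k$-points, $\lambda^*$ and $\phi^*$ are group homomorphisms on $\mathbb Q$-points and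 on $\overline k$-points, $\lambda^*$ is surjective on $\overline k$-points, $f\circ\phi^*=\lambda^*\circ f^*$, and $$\ker\lambda^*(\overline k)=\ker\lambda^*(\mathbb Q)=\langle(0,0)\rangle$$ is of order $5$. Moreover, there is an injective group homomorphism $$\kappa:\ E_{a,b}(\mathbb Q)/\phi^*(E^*_{a,b}(\mathbb Q))\hookrightarrow\mathrm{Hom}_{\mathrm{cont}}\bigl(\mathrm{Gal}(\overline k/k),\ker\lambda^*(\mathbb Q)\bigr),$$ where $\ker\lambda^*(\mathbb Q)$ is discrete, such that for every $P\in E_{a,b}(\mathbb Q)$, every $Q\in E^*_a(\overline k)$ with $\lambda^*(Q)=f(P)$, and every $\sigma\in\mathrm{Gal}(\overline k/k)$, $$\kappa([P])(\sigma)=\sigma(Q)-Q .$$ -/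

import Mathlib

open WeierstrassCurve WeierstrassCurve.Affine
open scoped Classical

namespace BrumerQuintic

/-- The quantity `d(a,b)`; the curves below are twisted by its square root. -/
def d (a b : ℚ) : ℚ :=
  -4 * b ^ 3 + (a ^ 2 - 30 * a + 1) * b ^ 2 + 2 * a * (3 * a + 1) * (4 * a - 7) * b
    - a * (4 * a ^ 4 - 4 * a ^ 3 - 40 * a ^ 2 + 91 * a - 4)

/-- The curve `E_{a,b}`. -/
def Eab (a b : ℚ) : Affine ℚ where
  a₁ := 0
  a₂ := d a b * (a ^ 2 - 30 * a + 1)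
  a₃ := 0
  a₄ := -8 * d a b ^ 2 * a * (3 * a + 1) * (4 * a - 7)
  a₆ := -16 * d a b ^ 3 * a * (4 * a ^ 4 - 4 * a ^ 3 - 40 * a ^ 2 + 91 * a - 4)

/-- The curve `E*_{a,b}`. -/
def EabStar (a b : ℚ) : Affine ℚ where
  a₁ := 0
  a₂ := (a ^ 2 - 30 * a + 1) * d a b
  a₃ := 0
  a₄ := -8 * (26 * a ^ 4 - 310 * a ^ 3 + 327 * a ^ 2 + 315 * a + 26) * d a b ^ 2
  a₆ := 16 * (68 * a ^ 6 - 1120 * a ^ 5 + 3804 * a ^ 4 + 1760 * a ^ 3 + 6929 * a ^ 2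
    + 1380 * a + 68) * d a b ^ 3

/-- The curve `E_a : y² - (a-1)xy - ay = x³ - ax² - 5a(a²+2a-1)x - a(a⁴+10a³-5a²+15a-1)`. -/
def Ea (a : ℚ) : Affine ℚ where
  a₁ := -(a - 1)
  a₂ := -a
  a₃ := -a
  a₄ := -5 * a * (a ^ 2 + 2 * a - 1)
  a₆ := -a * (a ^ 4 + 10 * a ^ 3 - 5 * a ^ 2 + 15 * a - 1)

/-- The curve `E*_a : y² - (a-1)xy - ay = x³ - ax²`. -/
def EaStar (a : ℚ) : Affine ℚ where
  a₁ := -(a - 1)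
  a₂ := -a
  a₃ := -a
  a₄ := 0
  a₆ := 0

lemma quad_ne_zero (a : ℚ) : a ^ 2 - 11 * a - 1 ≠ 0 := by
  intro h
  have h1 : IsSquare ((5 : ℚ)) := ⟨(2 * a - 11) / 5, by linear_combination (-4 / 25) * h⟩
  have h2 : IsSquare ((5 : ℕ)) := by
    rw [← Rat.isSquare_natCast_iff]
    exact_mod_cast h1
  obtain ⟨r, hr⟩ := h2
  have : r ≤ 2 := by nlinarith
  interval_cases r <;> omega

lemma Ea_Δ (a : ℚ) : (Ea a).Δ = a * (a ^ 2 - 11 * a - 1) ^ 5 := by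
  simp only [WeierstrassCurve.Δ, b₂, b₄, b₆, b₈, Ea]
  ring

lemma EaStar_Δ (a : ℚ) : (EaStar a).Δ = a ^ 5 * (a ^ 2 - 11 * a - 1) := by
  simp only [WeierstrassCurve.Δ, b₂, b₄, b₆, b₈, EaStar]
  ring

lemma Eab_Δ (a b : ℚ) : (Eab a b).Δ = (4 * d a b) ^ 6 * (a * (a ^ 2 - 11 * a - 1) ^ 5) := by
  simp only [WeierstrassCurve.Δ, b₂, b₄, b₆, b₈, Eab]
  ring

lemma EabStar_Δ (a b : ℚ) :
    (EabStar a b).Δ = (100 * d a b) ^ 6 * (a ^ 5 * (a ^ 2 - 11 * a - 1)) := by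
  simp only [WeierstrassCurve.Δ, b₂, b₄, b₆, b₈, EabStar]
  ring

lemma nonsingular_of_equation {W : Affine ℚ} (hW : W.Δ ≠ 0) {F : Type*} [Field F] [Algebra ℚ F]
    {x y : F} (h : (W⁄F).Equation x y) : (W⁄F).Nonsingular x y := by
  refine (equation_iff_nonsingular_of_Δ_ne_zero ?_).mp h
  change (WeierstrassCurve.map W (algebraMap ℚ F)).Δ ≠ 0
  rw [WeierstrassCurve.map_Δ]
  exact (map_ne_zero (algebraMap ℚ F)).mpr hW

lemma Ea_Δ_ne {a : ℚ} (ha : a ≠ 0) : (Ea a).Δ ≠ 0 := by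
  rw [Ea_Δ]
  exact mul_ne_zero ha (pow_ne_zero _ (quad_ne_zero a))

lemma EaStar_Δ_ne {a : ℚ} (ha : a ≠ 0) : (EaStar a).Δ ≠ 0 := by
  rw [EaStar_Δ]
  exact mul_ne_zero (pow_ne_zero _ ha) (quad_ne_zero a)

lemma Eab_Δ_ne {a b : ℚ} (ha : a ≠ 0) (hd : d a b ≠ 0) : (Eab a b).Δ ≠ 0 := by
  rw [Eab_Δ, ← Ea_Δ]
  exact mul_ne_zero (pow_ne_zero _ (mul_ne_zero (by norm_num) hd)) (Ea_Δ_ne ha)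

lemma EabStar_Δ_ne {a b : ℚ} (ha : a ≠ 0) (hd : d a b ≠ 0) : (EabStar a b).Δ ≠ 0 := by
  rw [EabStar_Δ, ← EaStar_Δ]
  exact mul_ne_zero (pow_ne_zero _ (mul_ne_zero (by norm_num) hd)) (EaStar_Δ_ne ha)

section Formulas

variable {F : Type*} [Field F]

/-- The numerator of the `x`-coordinate of `λ*`. -/
def lamNum (a x : F) : F :=
  x ^ 5 - 2 * a * x ^ 4 + a * (a ^ 2 + 3 * a - 1) * x ^ 3 - 3 * a ^ 2 * (a - 1) * x ^ 2
    + a ^ 3 * (a - 3) * x + a ^ 4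

/-- The `x`-coordinate of `λ*`. -/
def lamX (a x : F) : F := lamNum a x / (x ^ 2 * (x - a) ^ 2)

/-- The derivative of the rational function `lamX a` with respect to `x`. -/
def lamDX (a x : F) : F :=
  ((5 * x ^ 4 - 8 * a * x ^ 3 + 3 * a * (a ^ 2 + 3 * a - 1) * x ^ 2 - 6 * a ^ 2 * (a - 1) * x
      + a ^ 3 * (a - 3)) * (x * (x - a)) - 2 * (2 * x - a) * lamNum a x)
    / (x ^ 3 * (x - a) ^ 3)

/-- The `y`-coordinate of `λ*`, normalised so that the invariant differential
`dx / (2y - (a-1)x - a)` of `E_a` pulls back to that of `E*_a`; that is,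
`2Y - (a-1)X - a = X'(x) (2y - (a-1)x - a)`. -/
def lamY (a x y : F) : F :=
  (lamDX a x * (2 * y - (a - 1) * x - a) + (a - 1) * lamX a x + a) / 2

/-- The `x`-coordinate of `f* : E*_{a,b} → E*_a`, a function of `x` with rational coefficients. -/
def xi (a D x : F) : F := x / (100 * D) - 2 * (a ^ 2 - 5 * a + 1) / 25

/-- The `x`-coordinate of `φ*`. -/
def phiX (a D x : F) : F := 4 * D * (lamX a (xi a D x) + 2 * a)

/-- The `y`-coordinate of `φ*`, normalised so that `dx / y` on `E_{a,b}` pulls back to `5 dx / y`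
on `E*_{a,b}`; this is the normalisation of the dual of the normalised isogeny `φ`. -/
def phiY (a D x y : F) : F := y * lamDX a (xi a D x) / 125

end Formulas

section Maps

variable {F : Type*} [Field F] [Algebra ℚ F]

lemma lam_equation {a : ℚ} {x y : F} (h : ((EaStar a)⁄F).Equation x y)
    (hx : ¬(x = 0 ∨ x = (a : F))) :
    ((Ea a)⁄F).Equation (lamX (a : F) x) (lamY (a : F) x y) := by
  have := algebraRat.charZero F
  push Not at hx
  have h1 : x - a ≠ 0 := sub_ne_zero.mpr hx.2
  have h0 := hx.1
  rw [equation_iff] at h ⊢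
  simp [EaStar, Ea] at h ⊢
  have key : (lamDX (a : F) x) ^ 2 * (4 * x ^ 3 - 4 * a * x ^ 2 + ((a - 1) * x + a) ^ 2)
      = 4 * lamX (a : F) x ^ 3 - 4 * a * lamX (a : F) x ^ 2
        - 20 * a * (a ^ 2 + 2 * a - 1) * lamX (a : F) x
        - 4 * a * (a ^ 4 + 10 * a ^ 3 - 5 * a ^ 2 + 15 * a - 1)
        + ((a - 1) * lamX (a : F) x + a) ^ 2 := by
    simp only [lamDX, lamX, lamNum]
    field_simp
    ring
  simp only [lamY]
  linear_combination (1 / 4) * key + (lamDX (a : F) x) ^ 2 * h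

lemma phi_equation {a b : ℚ} (hd : d a b ≠ 0) {x y : F} (h : ((EabStar a b)⁄F).Equation x y)
    (hx : ¬(xi (a : F) (d a b : F) x = 0 ∨ xi (a : F) (d a b : F) x = (a : F))) :
    ((Eab a b)⁄F).Equation (phiX (a : F) (d a b : F) x) (phiY (a : F) (d a b : F) x y) := by
  have := algebraRat.charZero F
  have hD : (d a b : F) ≠ 0 := by exact_mod_cast hd
  push Not at hx
  have hxe : x = 100 * (d a b : F) * (xi (a : F) (d a b : F) x + 2 * (a ^ 2 - 5 * a + 1) / 25) := by
    simp only [xi]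
    field_simp
    ring
  rw [equation_iff] at h ⊢
  simp [EabStar, Eab] at h ⊢
  simp only [phiX, phiY]
  generalize xi (a : F) (d a b : F) x = z at *
  generalize (d a b : F) = D at *
  subst hxe
  obtain ⟨h0, h1⟩ := hx
  have h1 : z - a ≠ 0 := sub_ne_zero.mpr h1
  have key : (lamDX (a : F) z) ^ 2 * (4 * z ^ 3 - 4 * a * z ^ 2 + ((a - 1) * z + a) ^ 2)
      = 4 * lamX (a : F) z ^ 3 - 4 * a * lamX (a : F) z ^ 2
        - 20 * a * (a ^ 2 + 2 * a - 1) * lamX (a : F) z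
        - 4 * a * (a ^ 4 + 10 * a ^ 3 - 5 * a ^ 2 + 15 * a - 1)
        + ((a - 1) * lamX (a : F) z + a) ^ 2 := by
    simp only [lamDX, lamX, lamNum]
    field_simp
    ring
  linear_combination (16 * D ^ 3) * key + (lamDX (a : F) z) ^ 2 / 15625 * h

/-- The isogeny `λ* : E*_a → E_a` on `F`-points. The nonzero points with `x = 0` or `x = a` are the
nonzero multiples of `(0,0)`. -/
noncomputable def lamStar {a : ℚ} (ha : a ≠ 0) :
    ((EaStar a)⁄F).Point → ((Ea a)⁄F).Point
  | .zero => .zero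
  | .some x y h =>
    if hx : x = 0 ∨ x = (a : F) then .zero
    else .some (lamX (a : F) x) (lamY (a : F) x y)
      (nonsingular_of_equation (Ea_Δ_ne ha) (lam_equation h.1 hx))

/-- The isogeny `φ* : E*_{a,b} → E_{a,b}` over `ℚ`, on `F`-points; it is the isogeny that satisfies
`f ∘ φ* = λ* ∘ f*`. Its kernel consists of the zero point and the points that `f*` maps to points
with `x = 0` or `x = a`. -/
noncomputable def phiStar {a b : ℚ} (ha : a ≠ 0) (hd : d a b ≠ 0) :
    ((EabStar a b)⁄F).Point → ((Eab a b)⁄F).Point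
  | .zero => .zero
  | .some x y h =>
    if hx : xi (a : F) (d a b : F) x = 0 ∨ xi (a : F) (d a b : F) x = (a : F) then .zero
    else .some (phiX (a : F) (d a b : F) x) (phiY (a : F) (d a b : F) x y)
      (nonsingular_of_equation (Eab_Δ_ne ha hd) (phi_equation hd h.1 hx))

variable {k : Type*} [Field k] [Algebra k F]

lemma twist_equation {a b : ℚ} (hd : d a b ≠ 0) {s : k} (hs : s ^ 2 = (d a b : k)) {x y : F}
    (h : ((Eab a b)⁄F).Equation x y) :
    ((Ea a)⁄F).Equation (x / (4 * (d a b : F)) - 2 * a)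
      ((a - 1) / (8 * (d a b : F)) * x + y / (8 * (d a b : F) * algebraMap k F s)
        - a * (2 * a - 3) / 2) := by
  have := algebraRat.charZero F
  have hD : (d a b : F) ≠ 0 := by exact_mod_cast hd
  have ht : (algebraMap k F s) ^ 2 = (d a b : F) := by
    rw [← map_pow, hs, map_ratCast]
  rw [equation_iff] at h ⊢
  simp [Eab, Ea] at h ⊢
  generalize algebraMap k F s = t at *
  generalize (d a b : F) = D at *
  subst ht
  have ht : t ≠ 0 := by
    rintro rfl
    simp at hD
  field_simp
  linear_combination 256 * h

lemma twistStar_equation {a b : ℚ} (hd : d a b ≠ 0) {s : k} (hs : s ^ 2 = (d a b : k)) {x y : F}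
    (h : ((EabStar a b)⁄F).Equation x y) :
    ((EaStar a)⁄F).Equation (x / (100 * (d a b : F)) - 2 * (a ^ 2 - 5 * a + 1) / 25)
      ((a - 1) / (200 * (d a b : F)) * x + y / (1000 * (d a b : F) * algebraMap k F s)
        - (2 * a ^ 3 - 12 * a ^ 2 - 13 * a - 2) / 50) := by
  have := algebraRat.charZero F
  have hD : (d a b : F) ≠ 0 := by exact_mod_cast hd
  have ht : (algebraMap k F s) ^ 2 = (d a b : F) := by
    rw [← map_pow, hs, map_ratCast]
  rw [equation_iff] at h ⊢
  simp [EabStar, EaStar] at h ⊢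
  generalize algebraMap k F s = t at *
  generalize (d a b : F) = D at *
  subst ht
  have ht : t ≠ 0 := by
    rintro rfl
    simp at hD
  field_simp
  linear_combination 1562500000000000000 * h

/-- The isomorphism `f : E_{a,b} → E_a`, defined over a field `k` containing a square root `s` of
`d(a,b)`, on the points over an extension `F` of `k`. -/
noncomputable def twist {a b : ℚ} (ha : a ≠ 0) (hd : d a b ≠ 0) {s : k}
    (hs : s ^ 2 = (d a b : k)) : ((Eab a b)⁄F).Point → ((Ea a)⁄F).Point
  | .zero => .zero
  | .some _ _ h => .some _ _
      (nonsingular_of_equation (Ea_Δ_ne ha) (twist_equation hd hs h.1))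

/-- The isomorphism `f* : E*_{a,b} → E*_a`, defined over a field `k` containing a square root `s` of
`d(a,b)`, on the points over an extension `F` of `k`. -/
noncomputable def twistStar {a b : ℚ} (ha : a ≠ 0) (hd : d a b ≠ 0) {s : k}
    (hs : s ^ 2 = (d a b : k)) : ((EabStar a b)⁄F).Point → ((EaStar a)⁄F).Point
  | .zero => .zero
  | .some _ _ h => .some _ _
      (nonsingular_of_equation (EaStar_Δ_ne ha) (twistStar_equation hd hs h.1))

end Maps

/-- The point `(0,0)` of `E*_a(ℚ)`. -/
noncomputable def T {a : ℚ} (ha : a ≠ 0) : ((EaStar a)⁄ℚ).Point :=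
  .some 0 0 (nonsingular_of_equation (EaStar_Δ_ne ha)
    (by rw [equation_iff]; simp [EaStar]))

/-- `Hom_cont(G, A)`: the group of continuous homomorphisms from a topological group `G` to an
abelian group `A` with the discrete topology. -/
def HomCont (G A : Type*) [Group G] [TopologicalSpace G] [AddCommGroup A] :
    AddSubgroup (Additive G →+ A) where
  carrier := {χ | letI : TopologicalSpace A := ⊥; Continuous fun g : G => χ (Additive.ofMul g)}
  zero_mem' := by
    let : TopologicalSpace A := ⊥
    exact continuous_const
  add_mem' {χ ψ} hχ hψ := by
    let : TopologicalSpace A := ⊥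
    have : DiscreteTopology A := ⟨rfl⟩
    exact Continuous.add hχ hψ
  neg_mem' {χ} hχ := by
    let : TopologicalSpace A := ⊥
    have : DiscreteTopology A := ⟨rfl⟩
    exact Continuous.neg hχ

end BrumerQuintic

namespace BrumerQuintic

/-! The map `κ` is the Kummer map of `λ*`. Over the algebraic closure, `λ*` is surjective with
kernel generated by the rational point (0,0), so Galois acts trivially on the kernel. For P in
E_{a,b}(ℚ) the point f(P) is fixed by Gal(k̄/k), and for any Q above it σ ↦ σ(Q) - Q is a continuous
homomorphism to the kernel, independent of Q. `exists_kummer_map` is this argument for abstract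
modules.

The class of P dies exactly when f(P) has a preimage Q fixed by Gal(k̄/k), that is, when P = φ*(R)
with R = f*⁻¹(Q) fixed by that group. Injectivity modulo φ*(E*_{a,b}(ℚ)) requires a rational R. If τ
sends √d to -√d, then c = τ(R) - R lies in ker φ*, which is killed by 5 and on which τ acts as -1
because f* is a quadratic twist. Then R + 3c is fixed by τ as well (`exists_phiStar_eq`). The point
is that 2 is invertible modulo 5.

That the explicit formulas define homomorphisms is proved by hand. By `map_add_of_generic`, a map
with finite fibres on an infinite group need only be additive off degenerate configurations,
provided its zero fibre acts trivially. In the generic case three collinear points go to collinear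
points: `lamY_of_line` and `lamX_sum_of_line` do this for `λ*`, and it is immediate for the affine
maps f and f*. Additivity of φ* follows from f ∘ φ* = λ* ∘ f*. The results for `λ*` and φ* over
smaller fields descend from an algebraic closure. -/

/-- A map of groups that is additive away from its degenerate configurations is additive. -/
lemma map_add_of_generic {A B : Type*} [AddCommGroup A] [AddCommGroup B] [Infinite A] (g : A → B)
    (hker : ∀ P, g P = 0 → ∀ Q, g (P + Q) = g Q) (hfin : ∀ R, {P | g P = R}.Finite)
    (hgen : ∀ P Q, g P ≠ 0 → g Q ≠ 0 → g (P + Q) ≠ 0 → g P ≠ g Q → g P ≠ -g Q →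
      g (P + Q) = g P + g Q) (P Q : A) : g (P + Q) = g P + g Q := by
  -- For fixed P, additivity can fail only for Q in four finite sets: the fibres of `g` over 0, `g
  -- P` and `-g P`, and a translate of the zero fibre.
  have bad (P : A) : {Q | g (P + Q) ≠ g P + g Q}.Finite := by
    by_cases hP : g P = 0
    · simp [hker P hP, hP]
    refine (((hfin 0).union ((hfin 0).preimage (f := fun Q => P + Q)
      (add_right_injective P).injOn)).union ((hfin (g P)).union (hfin (-g P)))).subset ?_
    intro Q hQ
    by_contra h
    simp only [Set.mem_union, Set.mem_ofPred_eq, Set.mem_preimage, not_or] at h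
    exact hQ (hgen P Q hP h.1.1 h.1.2 (Ne.symm h.2.1) fun e => h.2.2 (by rw [e, neg_neg]))
  -- For a general R, g(P+Q) + g(R) = g(P+Q+R) = g(P) + g(Q+R) = g(P) + g(Q) + g(R), and g(R)
  -- cancels.
  obtain ⟨R, hR⟩ := (((bad Q).union ((bad P).preimage (f := fun R => Q + R)
    (add_right_injective Q).injOn)).union (bad (P + Q))).exists_notMem
  simp only [Set.mem_union, Set.mem_ofPred_eq, Set.mem_preimage, not_or, not_not] at hR
  have h := hR.2
  rw [add_assoc, hR.1.2, hR.1.1, ← add_assoc] at h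
  exact (add_right_cancel h).symm

/-! ### Images of lines under the quintic isogeny -/

section Formulas

variable {F : Type*} [Field F]

/-- The product of the values of `y - mx - c` at the four nonzero points of the kernel of `λ*`; it
vanishes if and only if the line `y = mx + c` meets the kernel. -/
def lineDen (a m c : F) : F := c * (c - a) * (m * a + c) * (m * a + c - a ^ 2)

/-- The numerator of the slope of the line on `E_a` that contains the image of `y = mx + c`. -/
def lineSlopeNum (a m c : F) : F :=
    - a ^ 5 * m ^ 2 + a ^ 5 * m * c - a ^ 5 * c + a ^ 4 * m ^ 3 - a ^ 4 * m * c
    + 3 * a ^ 4 * c ^ 2 - a ^ 3 * m ^ 3 * c - a ^ 3 * m ^ 2 * c ^ 2 + 3 * a ^ 3 * m ^ 2 * c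
    - 2 * a ^ 3 * m * c ^ 2 - a ^ 3 * c ^ 3 + a ^ 2 * m ^ 3 * c ^ 2 - 2 * a ^ 2 * m ^ 2 * c ^ 2
    - a ^ 2 * m * c ^ 3 + 3 * a ^ 2 * m * c ^ 2 - 2 * a ^ 2 * c ^ 3 + 2 * a * m ^ 2 * c ^ 3
    - a * m * c ^ 3 + a * c ^ 3 + m * c ^ 4

/-- The numerator of the constant term of the line on `E_a` that contains the image of
`y = mx + c`. -/
def lineConstNum (a m c : F) : F :=
    - a ^ 7 * m + a ^ 7 - a ^ 6 * m ^ 3 + a ^ 6 * m ^ 2 * c + a ^ 6 * m ^ 2 - 2 * a ^ 6 * m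
    + a ^ 6 * c ^ 2 - 3 * a ^ 6 * c + 2 * a ^ 5 * m ^ 4 - 2 * a ^ 5 * m ^ 3 * c + a ^ 5 * m ^ 2
    + a ^ 5 * m * c ^ 2 + 6 * a ^ 5 * m * c + 3 * a ^ 5 * c ^ 2 - 2 * a ^ 5 * c - a ^ 4 * m ^ 5
    + a ^ 4 * m ^ 4 * c - a ^ 4 * m ^ 4 + 5 * a ^ 4 * m ^ 3 * c - 6 * a ^ 4 * m ^ 2 * c ^ 2
    - 4 * a ^ 4 * m ^ 2 * c - a ^ 4 * m * c ^ 3 - a ^ 4 * m * c ^ 2 + 2 * a ^ 4 * m * c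
    - 3 * a ^ 4 * c ^ 3 + 4 * a ^ 4 * c ^ 2 - 3 * a ^ 3 * m ^ 4 * c + 3 * a ^ 3 * m ^ 3 * c ^ 2
    - 3 * a ^ 3 * m ^ 3 * c + a ^ 3 * m ^ 2 * c ^ 3 + 5 * a ^ 3 * m ^ 2 * c ^ 2
    - 2 * a ^ 3 * m * c ^ 3 - 7 * a ^ 3 * m * c ^ 2 + a ^ 3 * c ^ 3 + a ^ 3 * c ^ 2
    - 3 * a ^ 2 * m ^ 3 * c ^ 2 + 3 * a ^ 2 * m ^ 2 * c ^ 3 - 3 * a ^ 2 * m ^ 2 * c ^ 2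
    + a ^ 2 * m * c ^ 3 - a ^ 2 * c ^ 4 - 3 * a ^ 2 * c ^ 3 - a * m ^ 2 * c ^ 3
    + 2 * a * m * c ^ 4 - a * m * c ^ 3 - a * c ^ 4 + c ^ 5

/-- The product of the translates of y - mx - c by the five kernel points descends to E_a, with at
most a triple pole at zero, so it is a combination of 1, X and Y. This gives the image line. The
hypothesis `h` is the cubic cut out by y = mx + c, and the long cofactor is what clears the identity
modulo that cubic. -/
lemma lamY_of_line {a m c x : F} (h2 : (2 : F) ≠ 0) (hx : x ≠ 0) (hxa : x - a ≠ 0)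
    (h : x ^ 3 - a * x ^ 2 - (m * x + c) ^ 2 + (a - 1) * x * (m * x + c) + a * (m * x + c) = 0) :
    lineDen a m c * lamY a x (m * x + c) =
      lineSlopeNum a m c * lamX a x + lineConstNum a m c := by
  simp only [lamY, lamDX, lamX, lamNum, lineDen, lineSlopeNum, lineConstNum]
  field_simp
  linear_combination (
    2 * x ^ 4 * a ^ 5 * m ^ 2 - 2 * x ^ 4 * a ^ 5 * m * c + 2 * x ^ 4 * a ^ 5 * c
    - 2 * x ^ 4 * a ^ 4 * m ^ 3 + 2 * x ^ 4 * a ^ 4 * m ^ 2 * c + 2 * x ^ 4 * a ^ 4 * m * c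
    - 6 * x ^ 4 * a ^ 4 * c ^ 2 - 6 * x ^ 4 * a ^ 3 * m ^ 2 * c + 6 * x ^ 4 * a ^ 3 * m * c ^ 2
    + 2 * x ^ 4 * a ^ 3 * c ^ 3 - 6 * x ^ 4 * a ^ 2 * m * c ^ 2 + 4 * x ^ 4 * a ^ 2 * c ^ 3
    - 2 * x ^ 4 * a * c ^ 3 + 2 * x ^ 3 * a ^ 7 * m - 2 * x ^ 3 * a ^ 7
    - 6 * x ^ 3 * a ^ 6 * m ^ 2 + 2 * x ^ 3 * a ^ 6 * m * c + 4 * x ^ 3 * a ^ 6 * m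
    - 2 * x ^ 3 * a ^ 6 * c ^ 2 + 2 * x ^ 3 * a ^ 6 * c + 6 * x ^ 3 * a ^ 5 * m ^ 3
    - 6 * x ^ 3 * a ^ 5 * m ^ 2 * c - 2 * x ^ 3 * a ^ 5 * m ^ 2 + 4 * x ^ 3 * a ^ 5 * m * c ^ 2
    - 14 * x ^ 3 * a ^ 5 * m * c + 6 * x ^ 3 * a ^ 5 * c ^ 2 + 4 * x ^ 3 * a ^ 5 * c
    + 22 * x ^ 3 * a ^ 4 * m ^ 2 * c - 14 * x ^ 3 * a ^ 4 * m * c ^ 2 - 4 * x ^ 3 * a ^ 4 * m * c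
    + 2 * x ^ 3 * a ^ 4 * c ^ 3 - 8 * x ^ 3 * a ^ 4 * c ^ 2 + 26 * x ^ 3 * a ^ 3 * m * c ^ 2
    - 8 * x ^ 3 * a ^ 3 * c ^ 3 - 2 * x ^ 3 * a ^ 3 * c ^ 2 + 10 * x ^ 3 * a ^ 2 * c ^ 3
    - 2 * x ^ 2 * a ^ 8 * m + 2 * x ^ 2 * a ^ 8 * c + 4 * x ^ 2 * a ^ 8
    + 6 * x ^ 2 * a ^ 7 * m ^ 2 - 6 * x ^ 2 * a ^ 7 * m * c - 10 * x ^ 2 * a ^ 7 * m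
    - 6 * x ^ 2 * a ^ 7 * c - 6 * x ^ 2 * a ^ 6 * m ^ 3 + 6 * x ^ 2 * a ^ 6 * m ^ 2 * c
    + 6 * x ^ 2 * a ^ 6 * m ^ 2 + 24 * x ^ 2 * a ^ 6 * m * c - 6 * x ^ 2 * a ^ 6 * c ^ 2
    - 10 * x ^ 2 * a ^ 6 * c - 30 * x ^ 2 * a ^ 5 * m ^ 2 * c + 12 * x ^ 2 * a ^ 5 * m * c ^ 2
    + 12 * x ^ 2 * a ^ 5 * m * c + 18 * x ^ 2 * a ^ 5 * c ^ 2 - 42 * x ^ 2 * a ^ 4 * m * c ^ 2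
    + 6 * x ^ 2 * a ^ 4 * c ^ 3 + 6 * x ^ 2 * a ^ 4 * c ^ 2 - 18 * x ^ 2 * a ^ 3 * c ^ 3
    - 2 * x * a ^ 9 - 2 * x * a ^ 8 * m ^ 2 + 2 * x * a ^ 8 * m * c + 8 * x * a ^ 8 * m
    + 2 * x * a ^ 8 * c + 2 * x * a ^ 7 * m ^ 3 - 2 * x * a ^ 7 * m ^ 2 * c
    - 6 * x * a ^ 7 * m ^ 2 - 16 * x * a ^ 7 * m * c + 2 * x * a ^ 7 * c ^ 2 + 8 * x * a ^ 7 * c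
    + 18 * x * a ^ 6 * m ^ 2 * c - 4 * x * a ^ 6 * m * c ^ 2 - 12 * x * a ^ 6 * m * c
    - 14 * x * a ^ 6 * c ^ 2 + 30 * x * a ^ 5 * m * c ^ 2 - 2 * x * a ^ 5 * c ^ 3
    - 6 * x * a ^ 5 * c ^ 2 + 14 * x * a ^ 4 * c ^ 3 - 2 * a ^ 9 * m + 2 * a ^ 8 * m ^ 2
    + 4 * a ^ 8 * m * c - 2 * a ^ 8 * c - 4 * a ^ 7 * m ^ 2 * c + 4 * a ^ 7 * m * c
    + 4 * a ^ 7 * c ^ 2 - 8 * a ^ 6 * m * c ^ 2 + 2 * a ^ 6 * c ^ 2 - 4 * a ^ 5 * c ^ 3) * h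

/-- Partial fractions, with poles at the abscissae 0 and a of the kernel. In this form a sum over
three points reduces to power sums of inverses. -/
lemma lamX_eq_sum {a x : F} (hx : x ≠ 0) (hxa : x - a ≠ 0) :
    lamX a x = x + a * (a - 1) * x⁻¹ + a ^ 2 * x⁻¹ ^ 2 + a ^ 2 * (a + 1) * (x - a)⁻¹
      + a ^ 4 * (x - a)⁻¹ ^ 2 := by
  simp only [lamX, lamNum]
  field_simp
  ring

lemma lamDX_eq_sum {a x : F} (hx : x ≠ 0) (hxa : x - a ≠ 0) :
    lamDX a x = 1 - a * (a - 1) * x⁻¹ ^ 2 - 2 * a ^ 2 * x⁻¹ ^ 3 - a ^ 2 * (a + 1) * (x - a)⁻¹ ^ 2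
      - 2 * a ^ 4 * (x - a)⁻¹ ^ 3 := by
  simp only [lamDX, lamNum]
  field_simp
  ring

lemma sum_inv_three {x y z : F} (hx : x ≠ 0) (hy : y ≠ 0) (hz : z ≠ 0) :
    x⁻¹ + y⁻¹ + z⁻¹ = (x * y + x * z + y * z) / (x * y * z) := by
  field_simp
  ring

lemma sum_inv_sq_three {x y z : F} (hx : x ≠ 0) (hy : y ≠ 0) (hz : z ≠ 0) :
    x⁻¹ ^ 2 + y⁻¹ ^ 2 + z⁻¹ ^ 2 = ((x * y + x * z + y * z) / (x * y * z)) ^ 2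
      - 2 * (x + y + z) / (x * y * z) := by
  field_simp
  ring

/-- `s₁`, `s₂`, `s₃` are Vieta's relations for the cubic of the line. Up to sign, the factors of
`lineDen` are grouped into the values of this cubic at 0 and a. -/
lemma lineDen_ne_zero {a m c x₁ x₂ x₃ : F}
    (h₁ : x₁ ≠ 0) (h₂ : x₂ ≠ 0) (h₃ : x₃ ≠ 0) (k₁ : x₁ - a ≠ 0) (k₂ : x₂ - a ≠ 0)
    (k₃ : x₃ - a ≠ 0) (s₁ : x₁ + x₂ + x₃ = a + m ^ 2 - (a - 1) * m)
    (s₂ : x₁ * x₂ + x₁ * x₃ + x₂ * x₃ = -2 * m * c + (a - 1) * c + a * m)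
    (s₃ : x₁ * x₂ * x₃ = c ^ 2 - a * c) : lineDen a m c ≠ 0 := by
  have h : lineDen a m c = x₁ * x₂ * x₃ * ((x₁ - a) * (x₂ - a) * (x₃ - a)) := by
    have e : (x₁ - a) * (x₂ - a) * (x₃ - a) = (m * a + c) * (m * a + c - a ^ 2) := by
      linear_combination s₃ - a * s₂ + a ^ 2 * s₁
    rw [s₃, e, lineDen]
    ring
  rw [h]
  exact mul_ne_zero (mul_ne_zero (mul_ne_zero h₁ h₂) h₃) (mul_ne_zero (mul_ne_zero k₁ k₂) k₃)

/-- This is the chord law on E_a for the image line. Sums of inverses and of inverse squares of the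
xᵢ and the xᵢ - a are symmetric functions, hence rational in m and c. -/
lemma lamX_sum_of_line {a m c x₁ x₂ x₃ : F}
    (h₁ : x₁ ≠ 0) (h₂ : x₂ ≠ 0) (h₃ : x₃ ≠ 0) (k₁ : x₁ - a ≠ 0) (k₂ : x₂ - a ≠ 0)
    (k₃ : x₃ - a ≠ 0) (s₁ : x₁ + x₂ + x₃ = a + m ^ 2 - (a - 1) * m)
    (s₂ : x₁ * x₂ + x₁ * x₃ + x₂ * x₃ = -2 * m * c + (a - 1) * c + a * m)
    (s₃ : x₁ * x₂ * x₃ = c ^ 2 - a * c) :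
    lamX a x₁ + lamX a x₂ + lamX a x₃ = (lineSlopeNum a m c / lineDen a m c) ^ 2
      - (a - 1) * (lineSlopeNum a m c / lineDen a m c) + a := by
  have hD := lineDen_ne_zero h₁ h₂ h₃ k₁ k₂ k₃ s₁ s₂ s₃
  have t₁ : (x₁ - a) + (x₂ - a) + (x₃ - a) = -2 * a + m ^ 2 - (a - 1) * m := by
    linear_combination s₁
  have t₂ : (x₁ - a) * (x₂ - a) + (x₁ - a) * (x₃ - a) + (x₂ - a) * (x₃ - a) =
      -2 * m * c + (a - 1) * c + a * m - 2 * a * (a + m ^ 2 - (a - 1) * m) + 3 * a ^ 2 := by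
    linear_combination s₂ - 2 * a * s₁
  have t₃ : (x₁ - a) * (x₂ - a) * (x₃ - a) = (m * a + c) * (m * a + c - a ^ 2) := by
    linear_combination s₃ - a * s₂ + a ^ 2 * s₁
  have e : lamX a x₁ + lamX a x₂ + lamX a x₃ = (x₁ + x₂ + x₃)
      + a * (a - 1) * (x₁⁻¹ + x₂⁻¹ + x₃⁻¹) + a ^ 2 * (x₁⁻¹ ^ 2 + x₂⁻¹ ^ 2 + x₃⁻¹ ^ 2)
      + a ^ 2 * (a + 1) * ((x₁ - a)⁻¹ + (x₂ - a)⁻¹ + (x₃ - a)⁻¹)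
      + a ^ 4 * ((x₁ - a)⁻¹ ^ 2 + (x₂ - a)⁻¹ ^ 2 + (x₃ - a)⁻¹ ^ 2) := by
    rw [lamX_eq_sum h₁ k₁, lamX_eq_sum h₂ k₂, lamX_eq_sum h₃ k₃]
    ring
  -- The two denominators stay opaque while fractions are cleared, and are expanded only for the
  -- final identity.
  obtain ⟨p, hp⟩ : ∃ p, p = c ^ 2 - a * c := ⟨_, rfl⟩
  obtain ⟨q, hq⟩ : ∃ q, q = (m * a + c) * (m * a + c - a ^ 2) := ⟨_, rfl⟩
  have hpq : lineDen a m c = p * q := by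
    rw [hp, hq, lineDen]
    ring
  rw [e, sum_inv_three h₁ h₂ h₃, sum_inv_sq_three h₁ h₂ h₃, sum_inv_three k₁ k₂ k₃,
    sum_inv_sq_three k₁ k₂ k₃, s₁, s₂, s₃, t₁, t₂, t₃, ← hp, ← hq, hpq]
  rw [hpq, mul_ne_zero_iff] at hD
  obtain ⟨hp0, hq0⟩ := hD
  field_simp
  rw [hp, hq, lineSlopeNum]
  ring

end Formulas

/-! ### Invariance of the formulas under translation by (0,0) -/

section Translation

variable {F : Type*} [Field F]

/-- The translate of (x, y) by (0,0) has abscissa ay/x². The product of y and the ordinate of the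
negative point is -x²(x - a), which removes y from the denominator. -/
lemma inv_translate {a x y : F} (ha : a ≠ 0) (hx : x ≠ 0) (hxa : x - a ≠ 0)
    (h : y ^ 2 - (a - 1) * x * y - a * y = x ^ 3 - a * x ^ 2) :
    y ≠ 0 ∧ (a * y / x ^ 2)⁻¹ = -(-y + (a - 1) * x + a) / (a * (x - a)) := by
  have key : y * -(-y + (a - 1) * x + a) = x ^ 2 * (x - a) := by linear_combination h
  have hy : y ≠ 0 := left_ne_zero_of_mul (key ▸ mul_ne_zero (pow_ne_zero 2 hx) hxa)
  refine ⟨hy, inv_eq_of_mul_eq_one_right ?_⟩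
  field_simp
  linear_combination key

lemma inv_translate_sub {a x y : F} (ha : a ≠ 0) (hx : x ≠ 0) (hxa : x - a ≠ 0)
    (h : y ^ 2 - (a - 1) * x * y - a * y = x ^ 3 - a * x ^ 2) :
    a * y / x ^ 2 - a ≠ 0 ∧
      (a * y / x ^ 2 - a)⁻¹ = (-y + (a - 1) * x + a - x ^ 2) / (a * x * (x - a)) := by
  have key : (a * y / x ^ 2 - a) * ((-y + (a - 1) * x + a - x ^ 2) / (a * x * (x - a))) = 1 := by
    field_simp
    linear_combination -h
  exact ⟨left_ne_zero_of_mul (key ▸ one_ne_zero), inv_eq_of_mul_eq_one_right key⟩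

lemma lamX_translate {a x y : F} (ha : a ≠ 0) (hx : x ≠ 0) (hxa : x - a ≠ 0)
    (h : y ^ 2 - (a - 1) * x * y - a * y = x ^ 3 - a * x ^ 2) :
    lamX a (a * y / x ^ 2) = lamX a x := by
  obtain ⟨hy, hu⟩ := inv_translate ha hx hxa h
  obtain ⟨hxa', hv⟩ := inv_translate_sub ha hx hxa h
  rw [lamX_eq_sum (by positivity) hxa', hu, hv, lamX, lamNum]
  field_simp
  linear_combination (x ^ 2 + a ^ 2) * h

lemma lamY_translate {a x y : F} (ha : a ≠ 0) (hx : x ≠ 0) (hxa : x - a ≠ 0)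
    (h : y ^ 2 - (a - 1) * x * y - a * y = x ^ 3 - a * x ^ 2) :
    lamY a (a * y / x ^ 2) (a ^ 2 * (x ^ 2 - y) / x ^ 3) = lamY a x y := by
  obtain ⟨hy, hu⟩ := inv_translate ha hx hxa h
  obtain ⟨hxa', hv⟩ := inv_translate_sub ha hx hxa h
  -- Both sides express the pullback of the invariant differential of E_a relative to that of E*_a,
  -- so translation preserves them.
  have key : lamDX a (a * y / x ^ 2) *
      (2 * (a ^ 2 * (x ^ 2 - y) / x ^ 3) - (a - 1) * (a * y / x ^ 2) - a) =
      lamDX a x * (2 * y - (a - 1) * x - a) := by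
    rw [lamDX_eq_sum (by positivity) hxa', hu, hv, lamDX, lamNum]
    field_simp
    linear_combination (
      - x ^ 7 * a + x ^ 7 + 2 * x ^ 6 * y + x ^ 6 * a ^ 3 - x ^ 6 - 3 * x ^ 5 * y * a ^ 2
      + 2 * x ^ 5 * y * a - 3 * x ^ 5 * y + x ^ 5 * a ^ 4 - 4 * x ^ 5 * a ^ 2 + 3 * x ^ 5 * a
      + 2 * x ^ 4 * y ^ 2 * a - 2 * x ^ 4 * y ^ 2 - x ^ 4 * y * a ^ 3 - 8 * x ^ 4 * y * a ^ 2
      + 9 * x ^ 4 * y * a + 6 * x ^ 4 * a ^ 4 - 6 * x ^ 4 * a ^ 3 + 3 * x ^ 4 * a ^ 2 - x ^ 4 * a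
      + 4 * x ^ 3 * y ^ 2 * a - 7 * x ^ 3 * y * a ^ 3 - 2 * x ^ 3 * y * a ^ 2 - x ^ 3 * y * a
      - x ^ 3 * a ^ 5 + 14 * x ^ 3 * a ^ 4 - 19 * x ^ 3 * a ^ 3 + 6 * x ^ 3 * a ^ 2
      + 3 * x ^ 2 * y * a ^ 4 - 14 * x ^ 2 * y * a ^ 3 + 7 * x ^ 2 * y * a ^ 2 - 5 * x ^ 2 * a ^ 5
      + 22 * x ^ 2 * a ^ 4 - 13 * x ^ 2 * a ^ 3 - 2 * x * y ^ 2 * a ^ 3 + 2 * x * y ^ 2 * a ^ 2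
      + 10 * x * y * a ^ 4 - 14 * x * y * a ^ 3 - 8 * x * a ^ 5 + 12 * x * a ^ 4
      - 4 * y ^ 2 * a ^ 3 + 8 * y * a ^ 4 - 4 * a ^ 5) * h
  rw [lamY, key, lamX_translate ha hx hxa h, lamY]

end Translation

/-! ### Equations, negation and chord formulas of the four curves -/

section Curves

variable {F : Type*} [Field F] [Algebra ℚ F]

lemma EaStar_equation_iff {a : ℚ} {x y : F} : ((EaStar a)⁄F).Equation x y ↔
    y ^ 2 - ((a : F) - 1) * x * y - a * y = x ^ 3 - a * x ^ 2 := by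
  have := algebraRat.charZero F
  rw [equation_iff]
  simp [EaStar]
  constructor <;> intro h <;> linear_combination h

lemma Ea_equation_iff {a : ℚ} {x y : F} : ((Ea a)⁄F).Equation x y ↔
    y ^ 2 - ((a : F) - 1) * x * y - a * y = x ^ 3 - a * x ^ 2 - 5 * a * (a ^ 2 + 2 * a - 1) * x
      - a * (a ^ 4 + 10 * a ^ 3 - 5 * a ^ 2 + 15 * a - 1) := by
  have := algebraRat.charZero F
  rw [equation_iff]
  simp [Ea]
  constructor <;> intro h <;> linear_combination h

lemma EaStar_negY (a : ℚ) (x y : F) :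
    ((EaStar a)⁄F).negY x y = -y + ((a : F) - 1) * x + a := by
  have := algebraRat.charZero F
  simp [negY, EaStar]
  ring

lemma Ea_negY (a : ℚ) (x y : F) : ((Ea a)⁄F).negY x y = -y + ((a : F) - 1) * x + a := by
  have := algebraRat.charZero F
  simp [negY, Ea]
  ring

lemma Eab_negY (a b : ℚ) (x y : F) : ((Eab a b)⁄F).negY x y = -y := by
  simp [negY, Eab]

lemma EabStar_negY (a b : ℚ) (x y : F) : ((EabStar a b)⁄F).negY x y = -y := by
  simp [negY, EabStar]

lemma EaStar_addX (a : ℚ) (x₁ x₂ l : F) :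
    ((EaStar a)⁄F).addX x₁ x₂ l = l ^ 2 - ((a : F) - 1) * l + a - x₁ - x₂ := by
  have := algebraRat.charZero F
  simp [addX, EaStar]
  ring

lemma Ea_addX (a : ℚ) (x₁ x₂ l : F) :
    ((Ea a)⁄F).addX x₁ x₂ l = l ^ 2 - ((a : F) - 1) * l + a - x₁ - x₂ := by
  have := algebraRat.charZero F
  simp [addX, Ea]
  ring

lemma Eab_addX (a b : ℚ) (x₁ x₂ l : F) : ((Eab a b)⁄F).addX x₁ x₂ l =
    l ^ 2 - (d a b : F) * ((a : F) ^ 2 - 30 * a + 1) - x₁ - x₂ := by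
  have := algebraRat.charZero F
  simp [addX, Eab]

lemma EabStar_addX (a b : ℚ) (x₁ x₂ l : F) : ((EabStar a b)⁄F).addX x₁ x₂ l =
    l ^ 2 - ((a : F) ^ 2 - 30 * a + 1) * (d a b : F) - x₁ - x₂ := by
  have := algebraRat.charZero F
  simp [addX, EabStar]

end Curves

/-! ### Finiteness of fibres, existence of preimages, and the chord law -/

section Fibers

variable {F : Type*} [Field F]

/-- Besides zero, at most two points, negatives of each other, share an abscissa. -/
lemma finite_setOf_X_mem (W : Affine F) {S : Set F} (hS : S.Finite) :
    {P : W.Point | ∀ x y h, P = .some x y h → x ∈ S}.Finite := by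
  have hx (x : F) : {P : W.Point | ∃ y h, P = .some x y h}.Finite := by
    by_cases hne : ∃ y, W.Nonsingular x y
    · obtain ⟨y₀, h₀⟩ := hne
      refine (Set.toFinite {.some x y₀ h₀, -.some x y₀ h₀}).subset ?_
      rintro _ ⟨y, h, rfl⟩
      exact Point.X_eq_iff.mp rfl
    · refine Set.finite_empty.subset ?_
      rintro _ ⟨y, h, -⟩
      exact hne ⟨y, h⟩
  refine ((Set.finite_singleton 0).union (hS.biUnion fun x _ => hx x)).subset ?_
  rintro (_ | ⟨x, y, h⟩) hP
  · exact Or.inl rfl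
  · exact Or.inr (Set.mem_biUnion (hP x y h rfl) ⟨y, h, rfl⟩)

lemma exists_equation [IsAlgClosed F] (W : Affine F) (x : F) : ∃ y, W.Equation x y := by
  have hd : (Polynomial.X ^ 2 + Polynomial.C (W.a₁ * x + W.a₃) * Polynomial.X
      - Polynomial.C (x ^ 3 + W.a₂ * x ^ 2 + W.a₄ * x + W.a₆)).degree = 2 := by
    compute_degree!
  obtain ⟨y, hy⟩ := IsAlgClosed.exists_root _ (by rw [hd]; decide)
  refine ⟨y, (equation_iff ..).mpr ?_⟩
  simp [Polynomial.IsRoot] at hy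
  linear_combination hy

lemma infinite_point [IsAlgClosed F] (W : Affine F)
    (hW : ∀ x y, W.Equation x y → W.Nonsingular x y) :
    Infinite W.Point := by
  have : Infinite F := IsAlgClosed.instInfinite
  choose y hy using exists_equation W
  refine Infinite.of_injective (fun x => Point.some x (y x) (hW _ _ (hy x))) fun x x' h => ?_
  exact (Point.some.inj h).1

lemma add_some_of_line [DecidableEq F] {W : Affine F} {x₁ x₂ x₃ y₁ y₂ y₃ m c : F} (hx : x₁ ≠ x₂)
    (h₁ : W.Nonsingular x₁ y₁) (h₂ : W.Nonsingular x₂ y₂) (h₃ : W.Nonsingular x₃ y₃)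
    (l₁ : y₁ = m * x₁ + c) (l₂ : y₂ = m * x₂ + c) (l₃ : y₃ = W.negY x₃ (m * x₃ + c))
    (hs : x₃ = W.addX x₁ x₂ m) :
    Point.some x₁ y₁ h₁ + Point.some x₂ y₂ h₂ = Point.some x₃ y₃ h₃ := by
  have hm : W.slope x₁ x₂ y₁ y₂ = m := by
    rw [slope_of_X_ne hx, div_eq_iff (sub_ne_zero.mpr hx), l₁, l₂]
    ring
  rw [Point.add_of_X_ne hx, Point.some.injEq, hm, l₃, addY, negAddY, ← hs]
  refine ⟨rfl, ?_⟩
  rw [l₁]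
  congr 1
  ring

lemma exists_line_of_add [DecidableEq F] {W : Affine F} {x₁ x₂ x₃ y₁ y₂ y₃ : F} (hx : x₁ ≠ x₂)
    {h₁ : W.Nonsingular x₁ y₁} {h₂ : W.Nonsingular x₂ y₂} {h₃ : W.Nonsingular x₃ y₃}
    (h : Point.some x₁ y₁ h₁ + Point.some x₂ y₂ h₂ = Point.some x₃ y₃ h₃) :
    ∃ m c, y₁ = m * x₁ + c ∧ y₂ = m * x₂ + c ∧ y₃ = W.negY x₃ (m * x₃ + c) ∧
      x₃ = W.addX x₁ x₂ m := by
  rw [Point.add_of_X_ne hx, Point.some.injEq] at h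
  obtain ⟨e₁, e₂⟩ := h
  have hx' := sub_ne_zero.mpr hx
  refine ⟨W.slope x₁ x₂ y₁ y₂, y₁ - W.slope x₁ x₂ y₁ y₂ * x₁, by ring, ?_, ?_, e₁.symm⟩
  · rw [slope_of_X_ne hx]
    field_simp
    ring
  · rw [← e₂, addY, negAddY, e₁]
    congr 1
    ring

/-- The polynomial whose roots are the solutions `x` of `lamX α x = X₀`. -/
noncomputable def lamPoly (α X₀ : F) : Polynomial F :=
  Polynomial.X ^ 5 - Polynomial.C (2 * α + X₀) * Polynomial.X ^ 4
    + Polynomial.C (α * (α ^ 2 + 3 * α - 1) + 2 * α * X₀) * Polynomial.X ^ 3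
    - Polynomial.C (3 * α ^ 2 * (α - 1) + X₀ * α ^ 2) * Polynomial.X ^ 2
    + Polynomial.C (α ^ 3 * (α - 3)) * Polynomial.X + Polynomial.C (α ^ 4)

lemma lamPoly_natDegree (α X₀ : F) : (lamPoly α X₀).natDegree = 5 := by
  rw [lamPoly]
  compute_degree!

lemma lamPoly_eval (α X₀ x : F) :
    (lamPoly α X₀).eval x = lamNum α x - X₀ * (x ^ 2 * (x - α) ^ 2) := by
  simp only [lamPoly, lamNum, Polynomial.eval_add, Polynomial.eval_sub, Polynomial.eval_mul,
    Polynomial.eval_pow, Polynomial.eval_X, Polynomial.eval_C]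
  ring

lemma lamX_eq_iff {α X₀ x : F} (hx : x ≠ 0) (hxα : x ≠ α) :
    lamX α x = X₀ ↔ (lamPoly α X₀).IsRoot x := by
  rw [lamX, div_eq_iff (mul_ne_zero (pow_ne_zero 2 hx) (pow_ne_zero 2 (sub_ne_zero.mpr hxα))),
    Polynomial.IsRoot, lamPoly_eval, sub_eq_zero]

lemma finite_setOf_lamX_eq (α X₀ : F) :
    {x : F | x ≠ 0 ∧ x ≠ α ∧ lamX α x = X₀}.Finite := by
  have hp0 : lamPoly α X₀ ≠ 0 := Polynomial.ne_zero_of_natDegree_gt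
    (n := 0) (by rw [lamPoly_natDegree]; decide)
  exact (Polynomial.finite_setOfPred_isRoot hp0).subset
    fun x ⟨hx, hxα, h⟩ => (lamX_eq_iff hx hxα).mp h

lemma exists_lamX_eq [IsAlgClosed F] {α : F} (hα : α ≠ 0) (X₀ : F) :
    ∃ x : F, x ≠ 0 ∧ x ≠ α ∧ lamX α x = X₀ := by
  obtain ⟨x, hx⟩ := IsAlgClosed.exists_root (lamPoly α X₀)
    (Polynomial.degree_ne_of_natDegree_ne (by rw [lamPoly_natDegree]; decide))
  have h := hx
  rw [Polynomial.IsRoot, lamPoly_eval, lamNum] at h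
  -- The numerator takes the values α⁴ at 0 and α⁶ at α, so no root of `lamPoly` is a pole of
  -- `lamX`.
  have h0 : x ≠ 0 := by
    rintro rfl
    exact pow_ne_zero 4 hα (by linear_combination h)
  have h1 : x ≠ α := by
    rintro rfl
    exact pow_ne_zero 6 hα (by linear_combination h)
  exact ⟨x, h0, h1, (lamX_eq_iff h0 h1).mpr hx⟩

end Fibers

/-! ### The isogeny λ*: kernel, surjectivity, additivity -/

section LamStar

variable {F : Type*} [Field F] [Algebra ℚ F] {a : ℚ} (ha : a ≠ 0)

lemma lamStar_zero : lamStar ha (0 : ((EaStar a)⁄F).Point) = 0 := rfl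

lemma lamStar_some_of_mem {x y : F} (h : ((EaStar a)⁄F).Nonsingular x y)
    (hx : x = 0 ∨ x = (a : F)) : lamStar ha (Point.some x y h) = 0 := by
  rw [lamStar, dif_pos hx]
  rfl

lemma lamStar_some {x y : F} (h : ((EaStar a)⁄F).Nonsingular x y)
    (hx : ¬(x = 0 ∨ x = (a : F))) : lamStar ha (Point.some x y h) =
      Point.some (lamX (a : F) x) (lamY (a : F) x y)
        (nonsingular_of_equation (Ea_Δ_ne ha) (lam_equation h.1 hx)) := by
  rw [lamStar, dif_neg hx]

lemma lamStar_some_eq_zero_iff {x y : F} (h : ((EaStar a)⁄F).Nonsingular x y) :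
    lamStar ha (Point.some x y h) = 0 ↔ x = 0 ∨ x = (a : F) := by
  refine ⟨fun h0 => ?_, lamStar_some_of_mem ha h⟩
  by_contra hx
  rw [lamStar_some ha h hx] at h0
  exact Point.some_ne_zero _ h0

lemma lamY_neg (α x y : F) :
    lamY α x (-y + (α - 1) * x + α) = -lamY α x y + (α - 1) * lamX α x + α := by
  have := algebraRat.charZero F
  simp only [lamY]
  ring

lemma lamStar_neg (P : ((EaStar a)⁄F).Point) : lamStar ha (-P) = -lamStar ha P := by
  rcases P with _ | ⟨x, y, h⟩
  · rfl
  rw [Point.neg_some]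
  by_cases hx : x = 0 ∨ x = (a : F)
  · rw [lamStar_some_of_mem ha _ hx, lamStar_some_of_mem ha _ hx, Point.neg_zero]
  · rw [lamStar_some ha _ hx, lamStar_some ha _ hx, Point.neg_some, Point.some.injEq]
    refine ⟨rfl, ?_⟩
    rw [EaStar_negY, Ea_negY, lamY_neg]

/-- The formulas have rational coefficients. This gives Galois equivariance, and lets additivity
descend from an algebraic closure. -/
lemma lamStar_map [DecidableEq F] {K : Type*} [Field K] [DecidableEq K] [Algebra ℚ K]
    (σ : F →ₐ[ℚ] K)
    (P : ((EaStar a)⁄F).Point) : lamStar ha (Point.map σ P) = Point.map σ (lamStar ha P) := by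
  have hσ : σ (a : F) = (a : K) := map_ratCast σ a
  rcases P with _ | ⟨x, y, h⟩
  · rfl
  have hiff : σ x = 0 ∨ σ x = (a : K) ↔ x = 0 ∨ x = (a : F) := by
    rw [map_eq_zero, ← hσ]
    exact or_congr Iff.rfl ⟨fun e => σ.injective e, congrArg σ⟩
  rw [Point.map_some]
  by_cases hx : x = 0 ∨ x = (a : F)
  · rw [lamStar_some_of_mem ha _ hx, lamStar_some_of_mem ha _ (hiff.mpr hx), Point.map_zero]
  · rw [lamStar_some ha _ hx, lamStar_some ha _ (hiff.not.mpr hx), Point.map_some,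
      Point.some.injEq]
    constructor <;> simp only [lamX, lamY, lamDX, lamNum, map_div₀, map_add, map_sub, map_mul,
      map_pow, map_one, map_ofNat, hσ]

/-- The point `(0,0)` of `E*_a` over a field of characteristic zero. -/
noncomputable def origin (F : Type*) [Field F] [Algebra ℚ F] {a : ℚ} (ha : a ≠ 0) :
    ((EaStar a)⁄F).Point :=
  .some 0 0 (nonsingular_of_equation (EaStar_Δ_ne ha) (EaStar_equation_iff.mpr (by ring)))

variable [DecidableEq F]

lemma origin_add {x y : F} (h : ((EaStar a)⁄F).Nonsingular x y) (hx : x ≠ 0) :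
    ∃ h', origin F ha + Point.some x y h =
      Point.some ((a : F) * y / x ^ 2) ((a : F) ^ 2 * (x ^ 2 - y) / x ^ 3) h' := by
  have e := EaStar_equation_iff.mp h.1
  refine ⟨nonsingular_of_equation (EaStar_Δ_ne ha) (EaStar_equation_iff.mpr ?_),
    add_some_of_line hx.symm _ h _ (m := y / x) (c := 0) ?_ ?_ ?_ ?_⟩
  · field_simp
    linear_combination (a : F) ^ 3 * (x ^ 2 - y) * e
  · simp
  · field_simp
    ring
  · rw [EaStar_negY]
    field_simp
    linear_combination (a : F) * e
  · rw [EaStar_addX]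
    field_simp
    linear_combination -e

lemma origin_add_origin : ∃ h, origin F ha + origin F ha = Point.some (a : F) ((a : F) ^ 2) h := by
  have := algebraRat.charZero F
  have ha' : (a : F) ≠ 0 := Rat.cast_ne_zero.mpr ha
  have hy : (0 : F) ≠ ((EaStar a)⁄F).negY 0 0 := by
    rw [EaStar_negY]
    simpa using ha'.symm
  refine ⟨nonsingular_of_equation (EaStar_Δ_ne ha) (EaStar_equation_iff.mpr (by ring)), ?_⟩
  have hs : ((EaStar a)⁄F).slope 0 0 0 0 = 0 := by
    rw [slope_of_Y_ne rfl hy]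
    simp [EaStar]
  rw [origin, Point.add_self_of_Y_ne hy, Point.some.injEq, hs, addY, negAddY, EaStar_negY,
    EaStar_addX]
  constructor <;> ring

/-- With T = (0,0), the points with x = 0 are ±T and those with x = a are ±2T. -/
lemma mem_zmultiples_origin_of_X {x y : F} (h : ((EaStar a)⁄F).Nonsingular x y)
    (hx : x = 0 ∨ x = (a : F)) :
    Point.some x y h ∈ AddSubgroup.zmultiples (origin F ha) := by
  have h1 : origin F ha ∈ AddSubgroup.zmultiples (origin F ha) := AddSubgroup.mem_zmultiples _
  rcases hx with rfl | hx
  · rcases (Point.X_eq_iff (h₁ := h) (h₂ := (nonsingular_of_equation (EaStar_Δ_ne ha)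
      (EaStar_equation_iff.mpr (by ring)) : ((EaStar a)⁄F).Nonsingular 0 0))).mp rfl with e | e
    · exact e ▸ h1
    · exact e ▸ neg_mem h1
  · obtain ⟨h2, e2⟩ := origin_add_origin (F := F) ha
    have h2m := e2 ▸ add_mem h1 h1
    rcases (Point.X_eq_iff (h₁ := h) (h₂ := h2)).mp hx with e | e
    · exact e ▸ h2m
    · exact e ▸ neg_mem h2m

lemma lamStar_origin_add (Q : ((EaStar a)⁄F).Point) :
    lamStar ha (origin F ha + Q) = lamStar ha Q := by
  have := algebraRat.charZero F
  have ha' : (a : F) ≠ 0 := Rat.cast_ne_zero.mpr ha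
  have h0 : lamStar ha (origin F ha) = 0 := lamStar_some_of_mem ha _ (Or.inl rfl)
  obtain ⟨h2, e2⟩ := origin_add_origin (F := F) ha
  rcases Q with _ | ⟨x, y, h⟩
  · exact (congrArg _ (add_zero _)).trans h0
  by_cases hx0 : x = 0
  · subst hx0
    rw [lamStar_some_of_mem ha h (Or.inl rfl)]
    rcases (Point.X_eq_iff (h₁ := h) (h₂ := (nonsingular_of_equation (EaStar_Δ_ne ha)
      (EaStar_equation_iff.mpr (by ring)) : ((EaStar a)⁄F).Nonsingular 0 0))).mp rfl with e | e
    · rw [e]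
      change lamStar ha (origin F ha + origin F ha) = 0
      rw [e2, lamStar_some_of_mem ha _ (Or.inr rfl)]
    · rw [e]
      change lamStar ha (origin F ha + -origin F ha) = 0
      rw [add_neg_cancel, lamStar_zero]
  obtain ⟨h', e'⟩ := origin_add ha h hx0
  have e := EaStar_equation_iff.mp h.1
  rw [e']
  by_cases hxa : x = (a : F)
  · rw [lamStar_some_of_mem ha h (Or.inr hxa), lamStar_some_of_mem]
    subst hxa
    have : y * (y - a ^ 2) = 0 := by linear_combination e
    rcases mul_eq_zero.mp this with hy | hy
    · exact Or.inl (by rw [hy]; simp)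
    · exact Or.inr (by rw [sub_eq_zero.mp hy]; field_simp)
  · have hxa' := sub_ne_zero.mpr hxa
    have n1 : (a : F) * y / x ^ 2 ≠ 0 :=
      div_ne_zero (mul_ne_zero ha' (inv_translate ha' hx0 hxa' e).1) (pow_ne_zero 2 hx0)
    have n2 := sub_ne_zero.mp (inv_translate_sub ha' hx0 hxa' e).1
    rw [lamStar_some ha _ (not_or.mpr ⟨n1, n2⟩), lamStar_some ha _ (not_or.mpr ⟨hx0, hxa⟩),
      Point.some.injEq]
    exact ⟨lamX_translate ha' hx0 hxa' e, lamY_translate ha' hx0 hxa' e⟩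

lemma lamStar_eq_zero_iff (P : ((EaStar a)⁄F).Point) :
    lamStar ha P = 0 ↔ P ∈ AddSubgroup.zmultiples (origin F ha) := by
  constructor
  · intro h
    rcases P with _ | ⟨x, y, h'⟩
    · exact zero_mem _
    · exact mem_zmultiples_origin_of_X ha h' ((lamStar_some_eq_zero_iff ha h').mp h)
  · rintro ⟨n, rfl⟩
    simp only
    induction n with
    | zero => simp [lamStar_zero]
    | succ n ih => rw [add_zsmul, one_zsmul, add_comm, lamStar_origin_add, ih]
    | pred n ih => rwa [← lamStar_origin_add, sub_zsmul, one_zsmul, add_neg_cancel_comm_assoc]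

lemma lamStar_add_of_eq_zero {P : ((EaStar a)⁄F).Point} (hP : lamStar ha P = 0)
    (Q : ((EaStar a)⁄F).Point) : lamStar ha (P + Q) = lamStar ha Q := by
  obtain ⟨n, rfl⟩ := (lamStar_eq_zero_iff ha P).mp hP
  clear hP
  simp only
  induction n with
  | zero => simp
  | succ n ih => rw [add_zsmul, one_zsmul, add_comm _ (origin F ha), add_assoc,
      lamStar_origin_add, ih]
  | pred n ih => rwa [← lamStar_origin_add, sub_zsmul, one_zsmul, ← add_assoc,
      add_neg_cancel_comm_assoc]

lemma finite_setOf_lamStar_eq (R : ((Ea a)⁄F).Point) :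
    {P : ((EaStar a)⁄F).Point | lamStar ha P = R}.Finite := by
  rcases R with _ | ⟨X₀, Y₀, hR⟩
  · refine (finite_setOf_X_mem _ (Set.toFinite {0, (a : F)})).subset ?_
    rintro _ hP x y h rfl
    exact (lamStar_some_eq_zero_iff ha h).mp hP
  · refine (finite_setOf_X_mem _ (finite_setOf_lamX_eq (a : F) X₀)).subset ?_
    rintro _ hP x y h rfl
    have hP : lamStar ha (Point.some x y h) = _ := hP
    by_cases hx : x = 0 ∨ x = (a : F)
    · rw [lamStar_some_of_mem ha h hx] at hP
      exact absurd hP.symm (Point.some_ne_zero hR)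
    · rw [lamStar_some ha h hx, Point.some.injEq] at hP
      exact ⟨fun e => hx (Or.inl e), fun e => hx (Or.inr e), hP.1⟩

omit [DecidableEq F] in
lemma lamStar_surjective [IsAlgClosed F] :
    Function.Surjective (lamStar ha : ((EaStar a)⁄F).Point → ((Ea a)⁄F).Point) := by
  have := algebraRat.charZero F
  rintro (_ | ⟨X₀, Y₀, hR⟩)
  · exact ⟨0, rfl⟩
  obtain ⟨x, h0, h1, hX⟩ := exists_lamX_eq (Rat.cast_ne_zero.mpr ha : (a : F) ≠ 0) X₀
  obtain ⟨y, hy⟩ := exists_equation ((EaStar a)⁄F) x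
  have hn := nonsingular_of_equation (EaStar_Δ_ne ha) hy
  have e := lamStar_some ha hn (not_or.mpr ⟨h0, h1⟩)
  -- The abscissa fixes the image up to sign, and the sign is corrected by negating the preimage.
  rcases (Point.X_eq_iff (h₂ := hR)).mp hX with e' | e'
  · exact ⟨_, e.trans e'⟩
  · exact ⟨-Point.some x y hn, by rw [lamStar_neg, e, e', neg_neg]⟩

lemma lamStar_add_of_generic (P Q : ((EaStar a)⁄F).Point) (hP : lamStar ha P ≠ 0)
    (hQ : lamStar ha Q ≠ 0) (hPQ : lamStar ha (P + Q) ≠ 0) (h : lamStar ha P ≠ lamStar ha Q)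
    (h' : lamStar ha P ≠ -lamStar ha Q) :
    lamStar ha (P + Q) = lamStar ha P + lamStar ha Q := by
  have := algebraRat.charZero F
  generalize hR : P + Q = R at *
  rcases P with _ | ⟨x₁, y₁, h₁⟩
  · exact absurd rfl hP
  rcases Q with _ | ⟨x₂, y₂, h₂⟩
  · exact absurd rfl hQ
  rcases R with _ | ⟨x₃, y₃, h₃⟩
  · exact absurd rfl hPQ
  have hx : x₁ ≠ x₂ := by
    intro e
    rcases (Point.X_eq_iff (h₁ := h₁) (h₂ := h₂)).mp e with e | e
    · exact h (congrArg _ e)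
    · exact h' (by rw [e, lamStar_neg])
  obtain ⟨m, c, l₁, l₂, l₃, hs⟩ := exists_line_of_add hx hR
  have k₁ := (lamStar_some_eq_zero_iff ha h₁).not.mp hP
  have k₂ := (lamStar_some_eq_zero_iff ha h₂).not.mp hQ
  have k₃ := (lamStar_some_eq_zero_iff ha h₃).not.mp hPQ
  rw [lamStar_some ha h₁ k₁, lamStar_some ha h₂ k₂] at h h' ⊢
  rw [lamStar_some ha h₃ k₃]
  have hX : lamX (a : F) x₁ ≠ lamX (a : F) x₂ := fun e => by
    rcases Point.X_eq_iff.mp e with e | e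
    · exact h e
    · exact h' e
  push Not at k₁ k₂ k₃
  have e₁ := EaStar_equation_iff.mp h₁.1
  have e₂ := EaStar_equation_iff.mp h₂.1
  rw [EaStar_addX] at hs
  rw [EaStar_negY] at l₃
  rw [l₁] at e₁
  rw [l₂] at e₂
  have s₁ : x₁ + x₂ + x₃ = a + m ^ 2 - (a - 1) * m := by linear_combination hs
  -- The addition formula is the first Vieta relation. The difference of the cubic at x₁ and x₂,
  -- divided by x₁ - x₂, gives the second, and the cubic at x₁ the third.
  have s₂ : x₁ * x₂ + x₁ * x₃ + x₂ * x₃ = -2 * m * c + (a - 1) * c + a * m := by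
    refine mul_left_cancel₀ (sub_ne_zero.mpr hx) ?_
    linear_combination e₁ - e₂ + (x₁ - x₂) * (x₁ + x₂) * s₁
  have s₃ : x₁ * x₂ * x₃ = c ^ 2 - a * c := by
    linear_combination -e₁ + x₁ * s₂ - x₁ ^ 2 * s₁
  have e₃ : x₃ ^ 3 - a * x₃ ^ 2 - (m * x₃ + c) ^ 2 + (a - 1) * x₃ * (m * x₃ + c)
      + a * (m * x₃ + c) = 0 := by
    linear_combination s₃ - x₃ * s₂ + x₃ ^ 2 * s₁
  have n₁ := sub_ne_zero.mpr k₁.2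
  have n₂ := sub_ne_zero.mpr k₂.2
  have n₃ := sub_ne_zero.mpr k₃.2
  have hD := lineDen_ne_zero k₁.1 k₂.1 k₃.1 n₁ n₂ n₃ s₁ s₂ s₃
  have hline {x : F} (hx : x ≠ 0) (hxa : x - a ≠ 0) (e : x ^ 3 - a * x ^ 2 - (m * x + c) ^ 2
      + (a - 1) * x * (m * x + c) + a * (m * x + c) = 0) : lamY (a : F) x (m * x + c) =
      lineSlopeNum (a : F) m c / lineDen (a : F) m c * lamX (a : F) x
        + lineConstNum (a : F) m c / lineDen (a : F) m c := by
    refine mul_left_cancel₀ hD ((lamY_of_line two_ne_zero hx hxa e).trans ?_)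
    field_simp
  symm
  refine add_some_of_line hX _ _ _ (m := lineSlopeNum (a : F) m c / lineDen (a : F) m c)
    (c := lineConstNum (a : F) m c / lineDen (a : F) m c) ?_ ?_ ?_ ?_
  · rw [l₁]
    exact hline k₁.1 n₁ (by linear_combination -e₁)
  · rw [l₂]
    exact hline k₂.1 n₂ (by linear_combination -e₂)
  · rw [← hline k₃.1 n₃ e₃, Ea_negY, l₃, lamY_neg]
  · rw [Ea_addX]
    linear_combination lamX_sum_of_line k₁.1 k₂.1 k₃.1 n₁ n₂ n₃ s₁ s₂ s₃

lemma lamStar_add (P Q : ((EaStar a)⁄F).Point) :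
    lamStar ha (P + Q) = lamStar ha P + lamStar ha Q := by
  let K := AlgebraicClosure F
  let σ : F →ₐ[ℚ] K := IsScalarTower.toAlgHom ℚ F K
  have : Infinite ((EaStar a)⁄K).Point :=
    infinite_point _ fun _ _ => nonsingular_of_equation (EaStar_Δ_ne ha)
  have hadd := map_add_of_generic (lamStar ha : ((EaStar a)⁄K).Point → ((Ea a)⁄K).Point)
    (fun P hP Q => lamStar_add_of_eq_zero ha hP Q) (finite_setOf_lamStar_eq ha)
    (lamStar_add_of_generic ha)
  apply Point.map_injective (f := σ)
  rw [map_add, ← lamStar_map, ← lamStar_map, ← lamStar_map, map_add, hadd]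

/-- The isogeny `λ*` as a group homomorphism. -/
noncomputable def lamStarHom : ((EaStar a)⁄F).Point →+ ((Ea a)⁄F).Point where
  toFun := lamStar ha
  map_zero' := rfl
  map_add' := lamStar_add ha

lemma addOrderOf_origin : addOrderOf (origin F ha) = 5 := by
  have := algebraRat.charZero F
  have ha' : (a : F) ≠ 0 := Rat.cast_ne_zero.mpr ha
  obtain ⟨h2, e2⟩ := origin_add_origin (F := F) ha
  obtain ⟨h3, e3⟩ := origin_add ha h2 ha'
  have : Fact (Nat.Prime 5) := ⟨by norm_num⟩
  refine addOrderOf_eq_prime ?_ (Point.some_ne_zero _)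
  -- 2T = (a, a²) and 3T = (a, 0) are negatives of each other.
  have e : (2 : ℕ) • origin F ha = -((3 : ℕ) • origin F ha) := by
    rw [show (3 : ℕ) = 1 + 2 from rfl, add_nsmul, one_nsmul, two_nsmul, e2, e3, Point.neg_some,
      Point.some.injEq, EaStar_negY]
    constructor
    · field_simp
    · field_simp
      ring
  rw [show (5 : ℕ) = 2 + 3 from rfl, add_nsmul, e, neg_add_cancel]

end LamStar

/-! ### The twisting isomorphisms f and f* -/

section Twists

variable {F : Type*} [Field F] [Algebra ℚ F] {k : Type*} [Field k] [Algebra k F] {a b : ℚ}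
  (ha : a ≠ 0) (hd : d a b ≠ 0) {s : k} (hs : s ^ 2 = (d a b : k))

lemma Eab_equation_iff {x y : F} : ((Eab a b)⁄F).Equation x y ↔
    y ^ 2 = x ^ 3 + (d a b : F) * ((a : F) ^ 2 - 30 * a + 1) * x ^ 2
      - 8 * (d a b : F) ^ 2 * a * (3 * a + 1) * (4 * a - 7) * x
      - 16 * (d a b : F) ^ 3 * a * (4 * a ^ 4 - 4 * a ^ 3 - 40 * a ^ 2 + 91 * a - 4) := by
  have := algebraRat.charZero F
  rw [equation_iff]
  simp [Eab]
  constructor <;> intro h <;> linear_combination h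

lemma EabStar_equation_iff {x y : F} : ((EabStar a b)⁄F).Equation x y ↔
    y ^ 2 = x ^ 3 + ((a : F) ^ 2 - 30 * a + 1) * (d a b : F) * x ^ 2
      - 8 * (26 * (a : F) ^ 4 - 310 * a ^ 3 + 327 * a ^ 2 + 315 * a + 26) * (d a b : F) ^ 2 * x
      + 16 * (68 * (a : F) ^ 6 - 1120 * a ^ 5 + 3804 * a ^ 4 + 1760 * a ^ 3 + 6929 * a ^ 2
        + 1380 * a + 68) * (d a b : F) ^ 3 := by
  have := algebraRat.charZero F
  rw [equation_iff]
  simp [EabStar]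
  constructor <;> intro h <;> linear_combination h

omit [Algebra ℚ F] in
include hs in
lemma algebraMap_sq : (algebraMap k F s) ^ 2 = (d a b : F) := by
  rw [← map_pow, hs, map_ratCast]

include hd hs in
lemma algebraMap_sqrt_ne_zero : algebraMap k F s ≠ 0 := by
  have := algebraRat.charZero F
  intro h
  have e := algebraMap_sq (F := F) hs
  rw [h, zero_pow two_ne_zero] at e
  exact hd (Rat.cast_eq_zero.mp e.symm)

lemma twist_some {x y : F} (h : ((Eab a b)⁄F).Nonsingular x y) :
    twist ha hd hs (Point.some x y h) = Point.some _ _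
      (nonsingular_of_equation (Ea_Δ_ne ha) (twist_equation hd hs h.1)) := rfl

lemma twistStar_some {x y : F} (h : ((EabStar a b)⁄F).Nonsingular x y) :
    twistStar ha hd hs (Point.some x y h) = Point.some _ _
      (nonsingular_of_equation (EaStar_Δ_ne ha) (twistStar_equation hd hs h.1)) := rfl

lemma twist_neg (P : ((Eab a b)⁄F).Point) : twist ha hd hs (-P) = -twist ha hd hs P := by
  have := algebraRat.charZero F
  rcases P with _ | ⟨x, y, h⟩
  · rfl
  rw [Point.neg_some, twist_some, twist_some, Point.neg_some, Point.some.injEq, Ea_negY,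
    Eab_negY]
  exact ⟨rfl, by ring⟩

lemma twistStar_neg (P : ((EabStar a b)⁄F).Point) :
    twistStar ha hd hs (-P) = -twistStar ha hd hs P := by
  have := algebraRat.charZero F
  rcases P with _ | ⟨x, y, h⟩
  · rfl
  rw [Point.neg_some, twistStar_some, twistStar_some, Point.neg_some, Point.some.injEq,
    EaStar_negY, EabStar_negY]
  exact ⟨rfl, by ring⟩

lemma twist_injective :
    Function.Injective (twist ha hd hs : ((Eab a b)⁄F).Point → ((Ea a)⁄F).Point) := by
  have := algebraRat.charZero F
  have hD : (d a b : F) ≠ 0 := by exact_mod_cast hd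
  have ht := algebraMap_sqrt_ne_zero (F := F) hd hs
  rintro (_ | ⟨x₁, y₁, h₁⟩) (_ | ⟨x₂, y₂, h₂⟩) h
  · rfl
  · cases h
  · cases h
  rw [twist_some, twist_some, Point.some.injEq] at h
  obtain ⟨e₁, e₂⟩ := h
  have hx : x₁ = x₂ := by
    field_simp at e₁
    linear_combination e₁
  subst hx
  rw [Point.some.injEq]
  refine ⟨rfl, ?_⟩
  field_simp at e₂
  linear_combination e₂ / 2

lemma twistStar_injective :
    Function.Injective (twistStar ha hd hs : ((EabStar a b)⁄F).Point → ((EaStar a)⁄F).Point) := by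
  have := algebraRat.charZero F
  have hD : (d a b : F) ≠ 0 := by exact_mod_cast hd
  have ht := algebraMap_sqrt_ne_zero (F := F) hd hs
  rintro (_ | ⟨x₁, y₁, h₁⟩) (_ | ⟨x₂, y₂, h₂⟩) h
  · rfl
  · cases h
  · cases h
  rw [twistStar_some, twistStar_some, Point.some.injEq] at h
  obtain ⟨e₁, e₂⟩ := h
  have hx : x₁ = x₂ := by
    field_simp at e₁
    linear_combination e₁ / 25
  subst hx
  rw [Point.some.injEq]
  refine ⟨rfl, ?_⟩
  field_simp at e₂
  linear_combination e₂ / 10000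

lemma twist_surjective :
    Function.Surjective (twist ha hd hs : ((Eab a b)⁄F).Point → ((Ea a)⁄F).Point) := by
  have := algebraRat.charZero F
  have hD : (d a b : F) ≠ 0 := by exact_mod_cast hd
  have ht := algebraMap_sqrt_ne_zero (F := F) hd hs
  have hsq := algebraMap_sq (F := F) hs
  rintro (_ | ⟨x, y, h⟩)
  · exact ⟨0, rfl⟩
  have e := Ea_equation_iff.mp h.1
  -- The preimage comes from solving the affine formulas of f for x and y.
  have h' : ((Eab a b)⁄F).Equation (4 * (d a b : F) * (x + 2 * a))
      (8 * (d a b : F) * algebraMap k F s * (y - (a - 1) / 2 * (x + 2 * a)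
        + a * (2 * a - 3) / 2)) := by
    rw [Eab_equation_iff, mul_pow, mul_pow, hsq]
    linear_combination 64 * (d a b : F) ^ 3 * e
  refine ⟨.some _ _ (nonsingular_of_equation (Eab_Δ_ne ha hd) h'), ?_⟩
  rw [twist_some, Point.some.injEq]
  constructor
  · field_simp
    ring
  · field_simp
    ring

lemma twistStar_surjective :
    Function.Surjective
      (twistStar ha hd hs : ((EabStar a b)⁄F).Point → ((EaStar a)⁄F).Point) := by
  have := algebraRat.charZero F
  have hD : (d a b : F) ≠ 0 := by exact_mod_cast hd
  have ht := algebraMap_sqrt_ne_zero (F := F) hd hs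
  have hsq := algebraMap_sq (F := F) hs
  rintro (_ | ⟨x, y, h⟩)
  · exact ⟨0, rfl⟩
  have e := EaStar_equation_iff.mp h.1
  have h' : ((EabStar a b)⁄F).Equation
      (100 * (d a b : F) * (x + 2 * (a ^ 2 - 5 * a + 1) / 25))
      (1000 * (d a b : F) * algebraMap k F s * (y - (a - 1) / 2 * (x + 2 * (a ^ 2 - 5 * a + 1) / 25)
        + (2 * a ^ 3 - 12 * a ^ 2 - 13 * a - 2) / 50)) := by
    rw [EabStar_equation_iff, mul_pow, mul_pow, hsq]
    linear_combination 1000000 * (d a b : F) ^ 3 * e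
  refine ⟨.some _ _ (nonsingular_of_equation (EabStar_Δ_ne ha hd) h'), ?_⟩
  rw [twistStar_some, Point.some.injEq]
  constructor
  · field_simp
    ring
  · field_simp
    ring

variable [DecidableEq F]

lemma twist_add [IsAlgClosed F] (P Q : ((Eab a b)⁄F).Point) :
    twist ha hd hs (P + Q) = twist ha hd hs P + twist ha hd hs Q := by
  have := algebraRat.charZero F
  have hD : (d a b : F) ≠ 0 := by exact_mod_cast hd
  have ht := algebraMap_sqrt_ne_zero (F := F) hd hs
  have hsq := algebraMap_sq (F := F) hs
  have : Infinite ((Eab a b)⁄F).Point :=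
    infinite_point _ fun _ _ => nonsingular_of_equation (Eab_Δ_ne ha hd)
  have h0 : twist ha hd hs (0 : ((Eab a b)⁄F).Point) = 0 := rfl
  have hinj := twist_injective (F := F) ha hd hs
  refine map_add_of_generic _ (fun P hP Q => ?_)
    (fun R => Set.Subsingleton.finite fun P hP Q hQ => hinj (hP.trans hQ.symm))
    (fun P Q hP hQ hPQ h h' => ?_) P Q
  · rw [hinj (hP.trans (h0.symm : 0 = twist ha hd hs 0)), zero_add]
  generalize hR : P + Q = R at *
  rcases P with _ | ⟨x₁, y₁, h₁⟩
  · exact absurd rfl hP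
  rcases Q with _ | ⟨x₂, y₂, h₂⟩
  · exact absurd rfl hQ
  rcases R with _ | ⟨x₃, y₃, h₃⟩
  · exact absurd rfl hPQ
  have hx : x₁ ≠ x₂ := by
    intro e
    rcases (Point.X_eq_iff (h₁ := h₁) (h₂ := h₂)).mp e with e | e
    · exact h (congrArg _ e)
    · exact h' (by rw [e, twist_neg])
  obtain ⟨m, c, l₁, l₂, l₃, l₄⟩ := exists_line_of_add hx hR
  rw [Eab_negY] at l₃
  rw [Eab_addX] at l₄
  symm
  simp only [twist_some]
  -- The image line results from substituting x = 4d(X + 2a) and y = mx + c into the formula for the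
  -- ordinate of f.
  refine add_some_of_line (m := (a - 1) / 2 + m / (2 * algebraMap k F s))
    (c := a * (a - 1) + m * a / algebraMap k F s + c / (8 * (d a b : F) * algebraMap k F s)
      - a * (2 * a - 3) / 2)
    (fun e => hx ?_) _ _ _ ?_ ?_ ?_ ?_
  · field_simp at e
    linear_combination e
  · rw [l₁]
    field_simp
    ring
  · rw [l₂]
    field_simp
    ring
  · rw [Ea_negY, l₃]
    field_simp
    ring
  · rw [Ea_addX, l₄]
    field_simp
    rw [← hsq]
    ring

lemma twistStar_add [IsAlgClosed F] (P Q : ((EabStar a b)⁄F).Point) :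
    twistStar ha hd hs (P + Q) = twistStar ha hd hs P + twistStar ha hd hs Q := by
  have := algebraRat.charZero F
  have hD : (d a b : F) ≠ 0 := by exact_mod_cast hd
  have ht := algebraMap_sqrt_ne_zero (F := F) hd hs
  have hsq := algebraMap_sq (F := F) hs
  have : Infinite ((EabStar a b)⁄F).Point :=
    infinite_point _ fun _ _ => nonsingular_of_equation (EabStar_Δ_ne ha hd)
  have h0 : twistStar ha hd hs (0 : ((EabStar a b)⁄F).Point) = 0 := rfl
  have hinj := twistStar_injective (F := F) ha hd hs
  refine map_add_of_generic _ (fun P hP Q => ?_)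
    (fun R => Set.Subsingleton.finite fun P hP Q hQ => hinj (hP.trans hQ.symm))
    (fun P Q hP hQ hPQ h h' => ?_) P Q
  · rw [hinj (hP.trans (h0.symm : 0 = twistStar ha hd hs 0)), zero_add]
  generalize hR : P + Q = R at *
  rcases P with _ | ⟨x₁, y₁, h₁⟩
  · exact absurd rfl hP
  rcases Q with _ | ⟨x₂, y₂, h₂⟩
  · exact absurd rfl hQ
  rcases R with _ | ⟨x₃, y₃, h₃⟩
  · exact absurd rfl hPQ
  have hx : x₁ ≠ x₂ := by
    intro e
    rcases (Point.X_eq_iff (h₁ := h₁) (h₂ := h₂)).mp e with e | e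
    · exact h (congrArg _ e)
    · exact h' (by rw [e, twistStar_neg])
  obtain ⟨m, c, l₁, l₂, l₃, l₄⟩ := exists_line_of_add hx hR
  rw [EabStar_negY] at l₃
  rw [EabStar_addX] at l₄
  symm
  simp only [twistStar_some]
  refine add_some_of_line (m := (a - 1) / 2 + m / (10 * algebraMap k F s))
    (c := ((a - 1) / 2 + m / (10 * algebraMap k F s)) * (2 * (a ^ 2 - 5 * a + 1) / 25)
      + c / (1000 * (d a b : F) * algebraMap k F s)
      - (2 * a ^ 3 - 12 * a ^ 2 - 13 * a - 2) / 50)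
    (fun e => hx ?_) _ _ _ ?_ ?_ ?_ ?_
  · field_simp at e
    linear_combination e / 25
  · rw [l₁]
    field_simp
    ring
  · rw [l₂]
    field_simp
    ring
  · rw [EaStar_negY, l₃]
    field_simp
    ring
  · rw [EaStar_addX, l₄]
    field_simp
    rw [← hsq]
    ring

/-- The isomorphism `f` as an isomorphism of groups. -/
noncomputable def twistEquiv [IsAlgClosed F] : ((Eab a b)⁄F).Point ≃+ ((Ea a)⁄F).Point :=
  .ofBijective (AddMonoidHom.mk' (twist ha hd hs) (twist_add ha hd hs))
    ⟨twist_injective ha hd hs, twist_surjective ha hd hs⟩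

/-- The isomorphism `f*` as an isomorphism of groups. -/
noncomputable def twistStarEquiv [IsAlgClosed F] :
    ((EabStar a b)⁄F).Point ≃+ ((EaStar a)⁄F).Point :=
  .ofBijective (AddMonoidHom.mk' (twistStar ha hd hs) (twistStar_add ha hd hs))
    ⟨twistStar_injective ha hd hs, twistStar_surjective ha hd hs⟩

lemma twist_map_of_fixed (σ : F →ₐ[ℚ] F) (hσ : σ (algebraMap k F s) = algebraMap k F s)
    (P : ((Eab a b)⁄F).Point) :
    twist ha hd hs (Point.map σ P) = Point.map σ (twist ha hd hs P) := by
  rcases P with _ | ⟨x, y, h⟩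
  · rfl
  rw [Point.map_some, twist_some, twist_some, Point.map_some, Point.some.injEq]
  constructor <;> simp only [map_div₀, map_add, map_sub, map_mul, map_one, map_ofNat,
    map_ratCast, hσ]

lemma twistStar_map_of_fixed (σ : F →ₐ[ℚ] F) (hσ : σ (algebraMap k F s) = algebraMap k F s)
    (P : ((EabStar a b)⁄F).Point) :
    twistStar ha hd hs (Point.map σ P) = Point.map σ (twistStar ha hd hs P) := by
  rcases P with _ | ⟨x, y, h⟩
  · rfl
  rw [Point.map_some, twistStar_some, twistStar_some, Point.map_some, Point.some.injEq]
  constructor <;> simp only [map_div₀, map_add, map_sub, map_mul, map_pow, map_one, map_ofNat,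
    map_ratCast, hσ]

/-- Changing the sign of √d changes the sign of the y-term in f*, which is negation on E*_a. -/
lemma twistStar_map_of_neg (σ : F →ₐ[ℚ] F) (hσ : σ (algebraMap k F s) = -algebraMap k F s)
    (P : ((EabStar a b)⁄F).Point) :
    twistStar ha hd hs (Point.map σ P) = -Point.map σ (twistStar ha hd hs P) := by
  have := algebraRat.charZero F
  have hD : (d a b : F) ≠ 0 := by exact_mod_cast hd
  have ht := algebraMap_sqrt_ne_zero (F := F) hd hs
  rcases P with _ | ⟨x, y, h⟩
  · rfl
  rw [Point.map_some, twistStar_some, twistStar_some, Point.map_some, Point.neg_some,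
    Point.some.injEq, EaStar_negY]
  constructor <;> simp only [map_div₀, map_add, map_sub, map_mul, map_pow, map_one, map_ofNat,
    map_ratCast, hσ]
  field_simp
  ring

end Twists

/-! ### The isogeny φ*, obtained from λ* by twisting -/

section PhiStar

variable {F : Type*} [Field F] [Algebra ℚ F] {a b : ℚ} (ha : a ≠ 0) (hd : d a b ≠ 0)

lemma phiStar_some_of_mem {x y : F} (h : ((EabStar a b)⁄F).Nonsingular x y)
    (hx : xi (a : F) (d a b : F) x = 0 ∨ xi (a : F) (d a b : F) x = (a : F)) :
    phiStar ha hd (Point.some x y h) = 0 := by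
  rw [phiStar, dif_pos hx]
  rfl

lemma phiStar_some {x y : F} (h : ((EabStar a b)⁄F).Nonsingular x y)
    (hx : ¬(xi (a : F) (d a b : F) x = 0 ∨ xi (a : F) (d a b : F) x = (a : F))) :
    phiStar ha hd (Point.some x y h) = Point.some (phiX (a : F) (d a b : F) x)
      (phiY (a : F) (d a b : F) x y)
      (nonsingular_of_equation (Eab_Δ_ne ha hd) (phi_equation hd h.1 hx)) := by
  rw [phiStar, dif_neg hx]

lemma phiStar_map [DecidableEq F] {K : Type*} [Field K] [DecidableEq K] [Algebra ℚ K]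
    (σ : F →ₐ[ℚ] K) (P : ((EabStar a b)⁄F).Point) :
    phiStar ha hd (Point.map σ P) = Point.map σ (phiStar ha hd P) := by
  have hσ (q : ℚ) : σ (q : F) = (q : K) := map_ratCast σ q
  rcases P with _ | ⟨x, y, h⟩
  · rfl
  have hxi : xi (a : K) (d a b : K) (σ x) = σ (xi (a : F) (d a b : F) x) := by
    simp only [xi, map_div₀, map_add, map_sub, map_mul, map_pow, map_one, map_ofNat, hσ]
  have hiff : xi (a : K) (d a b : K) (σ x) = 0 ∨ xi (a : K) (d a b : K) (σ x) = (a : K) ↔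
      xi (a : F) (d a b : F) x = 0 ∨ xi (a : F) (d a b : F) x = (a : F) := by
    rw [hxi, map_eq_zero, ← hσ]
    exact or_congr Iff.rfl ⟨fun e => σ.injective e, congrArg σ⟩
  rw [Point.map_some]
  by_cases hx : xi (a : F) (d a b : F) x = 0 ∨ xi (a : F) (d a b : F) x = (a : F)
  · rw [phiStar_some_of_mem ha hd _ hx, phiStar_some_of_mem ha hd _ (hiff.mpr hx),
      Point.map_zero]
  · rw [phiStar_some ha hd _ hx, phiStar_some ha hd _ (hiff.not.mpr hx), Point.map_some,
      Point.some.injEq]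
    constructor <;> simp only [phiX, phiY, hxi, lamX, lamDX, lamNum, map_div₀, map_add, map_sub,
      map_mul, map_pow, map_one, map_ofNat, hσ]

variable {k : Type*} [Field k] [Algebra k F] {s : k} (hs : s ^ 2 = (d a b : k))

lemma twist_phiStar (P : ((EabStar a b)⁄F).Point) :
    twist ha hd hs (phiStar ha hd P) = lamStar ha (twistStar ha hd hs P) := by
  have := algebraRat.charZero F
  have hD : (d a b : F) ≠ 0 := by exact_mod_cast hd
  have ht := algebraMap_sqrt_ne_zero (F := F) hd hs
  rcases P with _ | ⟨x, y, h⟩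
  · rfl
  rw [twistStar_some]
  by_cases hx : xi (a : F) (d a b : F) x = 0 ∨ xi (a : F) (d a b : F) x = (a : F)
  · have hx' := hx
    simp only [xi] at hx'
    rw [phiStar_some_of_mem ha hd h hx, lamStar_some_of_mem ha _ hx']
    rfl
  · have hx' := hx
    simp only [xi] at hx'
    rw [phiStar_some ha hd h hx, lamStar_some ha _ hx', twist_some, Point.some.injEq]
    constructor
    · simp only [phiX, xi]
      field_simp
      ring
    · simp only [phiX, phiY, lamY, xi]
      generalize lamX (a : F) _ = X
      generalize lamDX (a : F) _ = Y
      field_simp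
      ring

lemma phiStar_add_of_isAlgClosed [DecidableEq F] [IsAlgClosed F]
    (P Q : ((EabStar a b)⁄F).Point) :
    phiStar ha hd (P + Q) = phiStar ha hd P + phiStar ha hd Q := by
  -- An algebraically closed F contains a square root of d, so F itself can play the role of k.
  obtain ⟨s, hs⟩ := IsAlgClosed.exists_pow_nat_eq (d a b : F) (n := 2) (by norm_num)
  apply twist_injective ha hd hs
  rw [twist_add, twist_phiStar, twist_phiStar, twist_phiStar, twistStar_add, lamStar_add]

lemma phiStar_add [DecidableEq F] (P Q : ((EabStar a b)⁄F).Point) :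
    phiStar ha hd (P + Q) = phiStar ha hd P + phiStar ha hd Q := by
  let K := AlgebraicClosure F
  let σ : F →ₐ[ℚ] K := IsScalarTower.toAlgHom ℚ F K
  apply Point.map_injective (f := σ)
  rw [map_add, ← phiStar_map, ← phiStar_map, ← phiStar_map, map_add, phiStar_add_of_isAlgClosed]

/-- The isogeny `φ*` as a group homomorphism. -/
noncomputable def phiStarHom [DecidableEq F] : ((EabStar a b)⁄F).Point →+ ((Eab a b)⁄F).Point where
  toFun := phiStar ha hd
  map_zero' := rfl
  map_add' := phiStar_add ha hd

end PhiStar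

/-! ### The abstract Kummer map -/

section Kummer

variable {G A B C M : Type*} [Group G] [TopologicalSpace G] [ContinuousMul G] [AddCommGroup A]
  [AddCommGroup B] [AddCommGroup C] [AddCommGroup M]

/-- The Kummer map of a surjective homomorphism of `G`-modules whose kernel has trivial action. -/
lemma exists_kummer_map (act : G → A →+ A)
    (act_mul : ∀ σ τ Q, act (σ * τ) Q = act σ (act τ Q)) (lam : A →+ B)
    (hsurj : Function.Surjective lam) (ι : M →+ A) (hι : Function.Injective ι)
    (hker : ∀ Q, lam Q = 0 → ∃ m, ι m = Q) (hfix : ∀ σ m, act σ (ι m) = ι m) (h : C →+ B)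
    (hact : ∀ P Q σ, lam Q = h P → lam (act σ Q) = h P) (hopen : ∀ Q, IsOpen {σ | act σ Q = Q})
    (N : AddSubgroup C) (hN : ∀ P, P ∈ N ↔ ∃ Q, lam Q = h P ∧ ∀ σ, act σ Q = Q) :
    ∃ κ : C ⧸ N →+ HomCont G M, Function.Injective κ ∧
      ∀ P Q, lam Q = h P → ∀ σ, ι ((κ (QuotientAddGroup.mk P)).1 (Additive.ofMul σ)) =
        act σ Q - Q := by
  choose q hq using fun P => hsurj (h P)
  have hdiff (P : C) (σ : G) : lam (act σ (q P) - q P) = 0 := by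
    rw [map_sub, hact P _ σ (hq P), hq, sub_self]
  choose c hc using fun P σ => hker _ (hdiff P σ)
  -- Two preimages differ by a kernel element, which the action fixes, so the cocycle does not
  -- depend on the choice of `q P`.
  have hcQ {P : C} {Q : A} (hQ : lam Q = h P) (σ : G) : ι (c P σ) = act σ Q - Q := by
    obtain ⟨m, hm⟩ := hker (Q - q P) (by rw [map_sub, hQ, hq, sub_self])
    have e : Q = q P + ι m := by rw [hm, add_sub_cancel]
    rw [hc, e, map_add, hfix, add_sub_add_right_eq_sub]
  have hmul (P : C) (σ τ : G) : c P (σ * τ) = c P σ + c P τ := by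
    apply hι
    have e : act σ (act τ (q P)) = act σ (q P) + ι (c P τ) := by
      rw [← hfix σ, hc, map_sub, add_sub_cancel]
    rw [map_add, hc P (σ * τ), act_mul, e, hc P σ]
    abel
  have hadd (P P' : C) (σ : G) : c (P + P') σ = c P σ + c P' σ := by
    apply hι
    rw [map_add, hcQ (P := P + P') (Q := q P + q P') (by rw [map_add, map_add, hq, hq]),
      hc, hc, map_add]
    abel
  have hcont (P : C) : letI : TopologicalSpace M := ⊥; Continuous (c P) := by
    let : TopologicalSpace M := ⊥
    have : DiscreteTopology M := ⟨rfl⟩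
    refine continuous_discrete_rng.mpr fun m => isOpen_iff_mem_nhds.mpr fun σ hσ => ?_
    -- The cocycle is constant on the coset of σ by the open stabiliser of `q P`.
    have ho : IsOpen ((fun τ => σ⁻¹ * τ) ⁻¹' {τ | act τ (q P) = q P}) :=
      (hopen (q P)).preimage (continuous_const_mul _)
    -- `act 1 = id` is not assumed. It follows at `q P` from the cocycle relation, which forces c(1)
    -- = c(1) + c(1).
    have one_act : act 1 (q P) = q P := by
      have e := hmul P 1 1
      rw [mul_one, left_eq_add] at e
      have e' := hc P 1
      rw [e, map_zero] at e'
      exact (sub_eq_zero.mp e'.symm)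
    refine Filter.mem_of_superset (ho.mem_nhds ?_) fun τ hτ => ?_
    · simpa using one_act
    · have hτ : act (σ⁻¹ * τ) (q P) = q P := hτ
      have hσ : c P σ = m := hσ
      change c P τ = m
      rw [← hσ]
      apply hι
      rw [hc, hc, ← mul_inv_cancel_left σ τ, act_mul, hτ]
  let κ₀ : C →+ HomCont G M := AddMonoidHom.mk'
    (fun P => ⟨AddMonoidHom.mk' (fun σ => c P σ.toMul) fun σ τ => hmul P σ.toMul τ.toMul,
      hcont P⟩) fun P P' => Subtype.ext (AddMonoidHom.ext fun σ => hadd P P' σ.toMul)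
  have hκ₀ (P : C) (σ : G) : (κ₀ P).1 (Additive.ofMul σ) = c P σ := rfl
  have hmem (P : C) : κ₀ P = 0 ↔ P ∈ N := by
    rw [hN]
    constructor
    · intro e
      refine ⟨q P, hq P, fun σ => ?_⟩
      rw [← sub_eq_zero, ← hc, ← hκ₀, e]
      exact map_zero ι
    · rintro ⟨Q, hQ, hfixQ⟩
      refine Subtype.ext (AddMonoidHom.ext fun σ => hι ?_)
      exact ((hcQ hQ σ.toMul).trans (by rw [hfixQ, sub_self])).trans (map_zero ι).symm
  refine ⟨QuotientAddGroup.lift N κ₀ fun P hP => (hmem P).mpr hP, ?_, fun P Q hQ σ => hcQ hQ σ⟩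
  rw [injective_iff_map_eq_zero]
  intro x
  induction x using QuotientAddGroup.induction_on with
  | H P => exact fun e => (QuotientAddGroup.eq_zero_iff P).mpr ((hmem P).mp e)

end Kummer

/-! ### Galois action on points -/

section Galois

variable {F : Type*} [Field F] [DecidableEq F]

lemma map_eq_self_iff {W : Affine ℚ} [Algebra ℚ F] (σ : F →ₐ[ℚ] F) {x y : F}
    (h : (W⁄F).Nonsingular x y) :
    Point.map σ (Point.some x y h) = Point.some x y h ↔ σ x = x ∧ σ y = y := by
  rw [Point.map_some, Point.some.injEq]

/-- The stabiliser of a point is the intersection of the stabilisers of its coordinates, each open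
because the coordinate is integral over k. -/
lemma isOpen_setOf_map_eq {k : Type*} [Field k] [Algebra k F] [Algebra.IsIntegral k F]
    [Algebra ℚ k] [Algebra ℚ F] [IsScalarTower ℚ k F] {W : Affine ℚ} (Q : (W⁄F).Point) :
    IsOpen {σ : F ≃ₐ[k] F | Point.map σ.toAlgHom Q = Q} := by
  rcases Q with _ | ⟨x, y, h⟩
  · convert isOpen_univ
    exact Set.eq_univ_of_forall fun σ => Point.map_zero _
  · convert (stabilizer_isOpen_of_isIntegral (K := k) x).inter
      (stabilizer_isOpen_of_isIntegral (K := k) y)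
    ext σ
    change Point.map σ.toAlgHom (Point.some x y h) = Point.some x y h ↔ σ x = x ∧ σ y = y
    rw [Point.map_some, Point.some.injEq]
    rfl

lemma exists_baseChange_eq [Algebra ℚ F] [IsGalois ℚ F] {W : Affine ℚ} (Q : (W⁄F).Point)
    (hQ : ∀ σ : F ≃ₐ[ℚ] F, Point.map σ.toAlgHom Q = Q) :
    ∃ P : (W⁄ℚ).Point, Point.baseChange ℚ F P = Q := by
  rcases Q with _ | ⟨x, y, h⟩
  · exact ⟨0, rfl⟩
  have hσ (σ : F ≃ₐ[ℚ] F) : σ x = x ∧ σ y = y := (map_eq_self_iff σ.toAlgHom h).mp (hQ σ)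
  obtain ⟨x, rfl⟩ := (InfiniteGalois.mem_range_algebraMap_iff_fixed x).mpr fun σ => (hσ σ).1
  obtain ⟨y, rfl⟩ := (InfiniteGalois.mem_range_algebraMap_iff_fixed y).mpr fun σ => (hσ σ).2
  exact ⟨.some x y ((W.baseChange_nonsingular (Algebra.ofId ℚ F).injective ..).mp h), rfl⟩

end Galois

/-! ### Descent of preimages from k to ℚ -/

section Descent

variable {F : Type*} [Field F] [DecidableEq F] [Algebra ℚ F] {k : Type*} [Field k] [Algebra k F]
  {a b : ℚ} (ha : a ≠ 0) (hd : d a b ≠ 0) {s : k} (hs : s ^ 2 = (d a b : k))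

lemma map_zsmul_origin {K : Type*} [Field K] [DecidableEq K] [Algebra ℚ K] (σ : F →ₐ[ℚ] K)
    (n : ℤ) : Point.map σ (n • origin F ha) = n • origin K ha := by
  rw [map_zsmul, origin, Point.map_some, origin]
  congr 1
  rw [Point.some.injEq]
  exact ⟨map_zero σ, map_zero σ⟩

omit [DecidableEq F] in
include hs in
lemma map_sqrt_eq_or (σ : F →ₐ[ℚ] F) :
    σ (algebraMap k F s) = algebraMap k F s ∨ σ (algebraMap k F s) = -algebraMap k F s := by
  rw [← sq_eq_sq_iff_eq_or_eq_neg, ← map_pow, algebraMap_sq (F := F) hs, map_ratCast]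

include hs in
lemma exists_twistStar_eq_zsmul_origin {R : ((EabStar a b)⁄F).Point} (h : phiStar ha hd R = 0) :
    ∃ n : ℤ, twistStar ha hd hs R = n • origin F ha := by
  have h0 : lamStar ha (twistStar ha hd hs R) = 0 := by
    rw [← twist_phiStar, h]
    rfl
  obtain ⟨n, hn⟩ := (lamStar_eq_zero_iff ha _).mp h0
  exact ⟨n, hn.symm⟩

include hs in
lemma five_nsmul_of_phiStar_eq_zero [IsAlgClosed F] {R : ((EabStar a b)⁄F).Point}
    (h : phiStar ha hd R = 0) : (5 : ℕ) • R = 0 := by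
  obtain ⟨n, hn⟩ := exists_twistStar_eq_zsmul_origin ha hd hs h
  have hn : twistStarEquiv ha hd hs R = n • origin F ha := hn
  apply (twistStarEquiv (F := F) ha hd hs).injective
  rw [map_nsmul, hn, smul_comm, ← addOrderOf_origin (F := F) ha, addOrderOf_nsmul_eq_zero,
    zsmul_zero, map_zero]

include hs in
lemma map_of_phiStar_eq_zero_of_fixed {R : ((EabStar a b)⁄F).Point} (h : phiStar ha hd R = 0)
    {σ : F →ₐ[ℚ] F} (hσ : σ (algebraMap k F s) = algebraMap k F s) : Point.map σ R = R := by
  obtain ⟨n, hn⟩ := exists_twistStar_eq_zsmul_origin ha hd hs h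
  apply twistStar_injective ha hd hs
  rw [twistStar_map_of_fixed ha hd hs σ hσ, hn, map_zsmul_origin]

include hs in
lemma map_of_phiStar_eq_zero_of_neg {R : ((EabStar a b)⁄F).Point} (h : phiStar ha hd R = 0)
    {σ : F →ₐ[ℚ] F} (hσ : σ (algebraMap k F s) = -algebraMap k F s) : Point.map σ R = -R := by
  obtain ⟨n, hn⟩ := exists_twistStar_eq_zsmul_origin ha hd hs h
  apply twistStar_injective ha hd hs
  rw [twistStar_map_of_neg ha hd hs σ hσ, twistStar_neg, hn, map_zsmul_origin]

include hs in
/-- A rational point with a preimage under `φ*` over `k` has a rational preimage: the nontrivial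
automorphism of `k` acts on the kernel of `φ*`, of order `5`, as `-1`. -/
lemma exists_phiStar_eq [IsAlgClosed F] [IsGalois ℚ F] {R : ((EabStar a b)⁄F).Point}
    {P : ((Eab a b)⁄ℚ).Point} (hR : phiStar ha hd R = Point.baseChange ℚ F P)
    (hfix : ∀ σ : F ≃ₐ[ℚ] F, σ (algebraMap k F s) = algebraMap k F s →
      Point.map σ.toAlgHom R = R) :
    ∃ R₀ : ((EabStar a b)⁄ℚ).Point, phiStar ha hd R₀ = P := by
  suffices ∃ R' : ((EabStar a b)⁄F).Point, phiStar ha hd R' = Point.baseChange ℚ F P ∧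
      ∀ σ : F ≃ₐ[ℚ] F, Point.map σ.toAlgHom R' = R' by
    obtain ⟨R', hR', hσ⟩ := this
    obtain ⟨R₀, rfl⟩ := exists_baseChange_eq R' hσ
    refine ⟨R₀, Point.map_injective (f := Algebra.ofId ℚ F) ?_⟩
    rw [← hR', phiStar_map]
  -- If every automorphism fixes √d, then R is already rational.
  by_cases H : ∀ τ : F ≃ₐ[ℚ] F, τ (algebraMap k F s) = algebraMap k F s
  · exact ⟨R, hR, fun σ => hfix σ (H σ)⟩
  push Not at H
  obtain ⟨τ, hτ⟩ := H
  have hτ : τ.toAlgHom (algebraMap k F s) = -algebraMap k F s :=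
    (map_sqrt_eq_or hs τ.toAlgHom).resolve_left hτ
  have hτR : phiStarHom ha hd (Point.map τ.toAlgHom R) = Point.baseChange ℚ F P := by
    change phiStar ha hd (Point.map τ.toAlgHom R) = _
    rw [phiStar_map, hR, Point.map_baseChange]
  have hR : phiStarHom ha hd R = Point.baseChange ℚ F P := hR
  obtain ⟨c, hc⟩ : ∃ c, c = Point.map τ.toAlgHom R - R := ⟨_, rfl⟩
  have hc0 : phiStarHom ha hd c = 0 := by rw [hc, map_sub, hτR, hR, sub_self]
  have hτc := map_of_phiStar_eq_zero_of_neg ha hd hs hc0 hτ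
  have h5 := five_nsmul_of_phiStar_eq_zero ha hd hs hc0
  have hfix' (σ : F ≃ₐ[ℚ] F) (hσ : σ (algebraMap k F s) = algebraMap k F s) :
      Point.map σ.toAlgHom (R + (3 : ℕ) • c) = R + (3 : ℕ) • c := by
    rw [map_add, map_nsmul, hfix σ hσ, map_of_phiStar_eq_zero_of_fixed ha hd hs hc0 hσ]
  -- τ(R + 3c) = (R + c) - 3c = R - 2c, which equals R + 3c because 5c = 0.
  have hτfix : Point.map τ.toAlgHom (R + (3 : ℕ) • c) = R + (3 : ℕ) • c := by
    rw [map_add, map_nsmul, hτc, eq_add_of_sub_eq' hc.symm, ← sub_eq_zero, ← neg_eq_zero, ← h5]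
    abel
  refine ⟨R + (3 : ℕ) • c, ?_, fun σ => ?_⟩
  · change phiStarHom ha hd (R + (3 : ℕ) • c) = _
    rw [map_add, map_nsmul, hc0, smul_zero, add_zero, hR]
  rcases map_sqrt_eq_or hs σ.toAlgHom with hσ | hσ
  · exact hfix' σ hσ
  -- An automorphism that negates √d is τ followed by one that fixes √d.
  · have e : (σ * τ⁻¹) * τ = σ := inv_mul_cancel_right σ τ
    have hστ : (σ * τ⁻¹) (algebraMap k F s) = algebraMap k F s := by
      have hτ' : τ⁻¹ (algebraMap k F s) = -algebraMap k F s := by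
        rw [AlgEquiv.aut_inv, AlgEquiv.symm_apply_eq, map_neg]
        exact (neg_eq_iff_eq_neg.mpr hτ).symm
      rw [AlgEquiv.mul_apply, hτ', map_neg]
      exact neg_eq_iff_eq_neg.mpr hσ
    have e' : σ.toAlgHom = (σ * τ⁻¹).toAlgHom.comp τ.toAlgHom := by
      conv_lhs => rw [← e]
      rfl
    rw [e', ← Point.map_map, hτfix, hfix' _ hστ]

omit [DecidableEq F] in
lemma map_algebraMap_of_adjoin_eq_top [CharZero k] [IsScalarTower ℚ k F]
    (hk : IntermediateField.adjoin ℚ {s} = ⊤) {σ : F ≃ₐ[ℚ] F}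
    (hσ : σ (algebraMap k F s) = algebraMap k F s) (z : k) :
    σ (algebraMap k F z) = algebraMap k F z := by
  have hz : z ∈ IntermediateField.adjoin ℚ {s} := hk ▸ IntermediateField.mem_top
  induction hz using IntermediateField.adjoin_induction with
  | mem x hx => rwa [Set.mem_singleton_iff.mp hx]
  | algebraMap q => simp
  | add x y _ _ hx hy => rw [map_add, map_add, hx, hy]
  | inv x _ hx => rw [map_inv₀, map_inv₀, hx]
  | mul x y _ _ hx hy => rw [map_mul, map_mul, hx, hy]

end Descent

/-- Makes the algebraic closure of k an algebraic closure of ℚ, hence Galois over ℚ. -/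
lemma isAlgebraic_of_adjoin_sqrt {k : Type*} [Field k] [CharZero k] {s : k} {q : ℚ}
    (hs : s ^ 2 = (q : k)) (hk : IntermediateField.adjoin ℚ {s} = ⊤) : Algebra.IsAlgebraic ℚ k := by
  have hsi : IsIntegral ℚ s := by
    refine IsIntegral.of_pow (n := 2) (by norm_num) ?_
    rw [hs, ← eq_ratCast (algebraMap ℚ k)]
    exact isIntegral_algebraMap
  have := IntermediateField.isAlgebraic_adjoin_simple hsi
  rw [hk] at this
  exact (IntermediateField.topEquiv (F := ℚ) (E := k)).isAlgebraic_iff.mp this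

end BrumerQuintic

/-! ### The theorem -/

theorem theorem3p1 (a b : ℚ) (ha : a ≠ 0) (hd : BrumerQuintic.d a b ≠ 0)
    {k : Type*} [Field k] [CharZero k] (s : k) (hs : s ^ 2 = (BrumerQuintic.d a b : k))
    (hk : IntermediateField.adjoin ℚ {s} = ⊤) :
    ∃ (lamQ : ((BrumerQuintic.EaStar a)⁄ℚ).Point →+ ((BrumerQuintic.Ea a)⁄ℚ).Point)
      (lamK : ((BrumerQuintic.EaStar a)⁄(AlgebraicClosure k)).Point →+
        ((BrumerQuintic.Ea a)⁄(AlgebraicClosure k)).Point)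
      (phiQ : ((BrumerQuintic.EabStar a b)⁄ℚ).Point →+ ((BrumerQuintic.Eab a b)⁄ℚ).Point)
      (phiK : ((BrumerQuintic.EabStar a b)⁄(AlgebraicClosure k)).Point →+
        ((BrumerQuintic.Eab a b)⁄(AlgebraicClosure k)).Point)
      (f : ((BrumerQuintic.Eab a b)⁄(AlgebraicClosure k)).Point ≃+
        ((BrumerQuintic.Ea a)⁄(AlgebraicClosure k)).Point)
      (fStar : ((BrumerQuintic.EabStar a b)⁄(AlgebraicClosure k)).Point ≃+
        ((BrumerQuintic.EaStar a)⁄(AlgebraicClosure k)).Point),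
      -- these homomorphisms are the maps given by the explicit formulas
      (∀ P, lamQ P = BrumerQuintic.lamStar ha P) ∧
      (∀ P, lamK P = BrumerQuintic.lamStar ha P) ∧
      (∀ P, phiQ P = BrumerQuintic.phiStar ha hd P) ∧
      (∀ P, phiK P = BrumerQuintic.phiStar ha hd P) ∧
      (∀ P, f P = BrumerQuintic.twist ha hd hs P) ∧
      (∀ P, fStar P = BrumerQuintic.twistStar ha hd hs P) ∧
      -- the kernel of `λ*` is generated by the rational point `(0,0)` of order 5
      addOrderOf (BrumerQuintic.T ha) = 5 ∧
      lamQ.ker = AddSubgroup.zmultiples (BrumerQuintic.T ha) ∧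
      lamK.ker = lamQ.ker.map (Point.baseChange ℚ (AlgebraicClosure k)) ∧
      -- `λ*` is surjective on geometric points, and `f ∘ φ* = λ* ∘ f*`
      Function.Surjective lamK ∧
      (∀ P, f (phiK P) = lamK (fStar P)) ∧
      -- the injection, given by the Kummer map of `λ*` composed with `f`
      ∃ κ : ((BrumerQuintic.Eab a b)⁄ℚ).Point ⧸ phiQ.range →+
          BrumerQuintic.HomCont (AlgebraicClosure k ≃ₐ[k] AlgebraicClosure k) lamQ.ker,
        Function.Injective κ ∧
        ∀ (P : ((BrumerQuintic.Eab a b)⁄ℚ).Point)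
          (Q : ((BrumerQuintic.EaStar a)⁄(AlgebraicClosure k)).Point),
          lamK Q = f (Point.baseChange ℚ (AlgebraicClosure k) P) →
          ∀ σ : AlgebraicClosure k ≃ₐ[k] AlgebraicClosure k,
            Point.baseChange ℚ (AlgebraicClosure k)
                ((κ (QuotientAddGroup.mk P)).1 (Additive.ofMul σ)).1 =
              Point.map σ.toAlgHom Q - Q := by
  have : Algebra.IsAlgebraic ℚ k := BrumerQuintic.isAlgebraic_of_adjoin_sqrt hs hk
  have : Algebra.IsAlgebraic ℚ (AlgebraicClosure k) := Algebra.IsAlgebraic.trans ℚ k _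
  have : IsAlgClosure ℚ (AlgebraicClosure k) := ⟨inferInstance, inferInstance⟩
  have : IsGalois ℚ (AlgebraicClosure k) := IsAlgClosure.isGalois ℚ _
  -- Identifies the action of a k-automorphism on points with that of its restriction to a
  -- ℚ-automorphism.
  have hmap {W : Affine ℚ} (σ : AlgebraicClosure k ≃ₐ[k] AlgebraicClosure k)
      (P : (W⁄(AlgebraicClosure k)).Point) :
      Point.map σ.toAlgHom P = Point.map (σ.restrictScalars ℚ).toAlgHom P := by
    rcases P with _ | _ <;> rfl
  have hfixs (σ : AlgebraicClosure k ≃ₐ[k] AlgebraicClosure k) :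
      (σ.restrictScalars ℚ).toAlgHom (algebraMap k _ s) = algebraMap k _ s := σ.commutes s
  have hfixt (σ : AlgebraicClosure k ≃ₐ[k] AlgebraicClosure k)
      (P : ((BrumerQuintic.Eab a b)⁄ℚ).Point) :
      Point.map (σ.restrictScalars ℚ).toAlgHom (BrumerQuintic.twist ha hd hs
        (Point.baseChange ℚ (AlgebraicClosure k) P)) =
      BrumerQuintic.twist ha hd hs (Point.baseChange ℚ (AlgebraicClosure k) P) := by
    rw [← BrumerQuintic.twist_map_of_fixed ha hd hs _ (hfixs σ), Point.map_baseChange]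
  have hker (m : (BrumerQuintic.lamStarHom (F := ℚ) ha).ker) :
      ∃ n : ℤ, n • BrumerQuintic.origin ℚ ha = m.1 :=
    (BrumerQuintic.lamStar_eq_zero_iff ha m.1).mp m.2
  refine ⟨BrumerQuintic.lamStarHom ha, BrumerQuintic.lamStarHom ha, BrumerQuintic.phiStarHom ha hd,
    BrumerQuintic.phiStarHom ha hd, BrumerQuintic.twistEquiv ha hd hs,
    BrumerQuintic.twistStarEquiv ha hd hs, fun _ => rfl, fun _ => rfl, fun _ => rfl, fun _ => rfl,
    fun _ => rfl, fun _ => rfl, BrumerQuintic.addOrderOf_origin ha, ?_, ?_,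
    BrumerQuintic.lamStar_surjective ha, BrumerQuintic.twist_phiStar ha hd hs, ?_⟩
  · ext P
    exact BrumerQuintic.lamStar_eq_zero_iff ha P
  · ext P
    rw [AddSubgroup.mem_map]
    constructor
    · intro hP
      obtain ⟨n, rfl⟩ := (BrumerQuintic.lamStar_eq_zero_iff ha P).mp hP
      exact ⟨n • BrumerQuintic.origin ℚ ha,
        (BrumerQuintic.lamStar_eq_zero_iff ha _).mpr ⟨n, rfl⟩,
        BrumerQuintic.map_zsmul_origin ha _ n⟩
    · rintro ⟨Q, hQ, rfl⟩
      obtain ⟨n, hn⟩ := hker ⟨Q, hQ⟩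
      change n • _ = Q at hn
      rw [← hn, BrumerQuintic.map_zsmul_origin]
      exact (BrumerQuintic.lamStar_eq_zero_iff ha _).mpr ⟨n, rfl⟩
  · refine BrumerQuintic.exists_kummer_map
      (act := fun σ : AlgebraicClosure k ≃ₐ[k] AlgebraicClosure k => Point.map σ.toAlgHom)
      (fun σ τ Q => (Point.map_map τ.toAlgHom σ.toAlgHom Q).symm)
      (BrumerQuintic.lamStarHom (F := AlgebraicClosure k) ha) (BrumerQuintic.lamStar_surjective ha)
      ((Point.baseChange ℚ (AlgebraicClosure k)).comp
        (BrumerQuintic.lamStarHom (F := ℚ) ha).ker.subtype)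
      ((Point.map_injective _).comp Subtype.val_injective) ?_ ?_
      ((BrumerQuintic.twistEquiv (F := AlgebraicClosure k) ha hd hs).toAddMonoidHom.comp
        (Point.baseChange ℚ (AlgebraicClosure k))) ?_ BrumerQuintic.isOpen_setOf_map_eq _ ?_
    · intro Q hQ
      obtain ⟨n, rfl⟩ := (BrumerQuintic.lamStar_eq_zero_iff ha Q).mp hQ
      exact ⟨⟨n • BrumerQuintic.origin ℚ ha,
        (BrumerQuintic.lamStar_eq_zero_iff ha _).mpr ⟨n, rfl⟩⟩,
        BrumerQuintic.map_zsmul_origin ha _ n⟩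
    · intro σ m
      exact (hmap σ _).trans (Point.map_baseChange _ m.1)
    · intro P Q σ hQ
      have hQ : BrumerQuintic.lamStar ha Q = BrumerQuintic.twist ha hd hs _ := hQ
      change BrumerQuintic.lamStar ha (Point.map σ.toAlgHom Q) = BrumerQuintic.twist ha hd hs _
      rw [hmap, BrumerQuintic.lamStar_map, hQ]
      exact hfixt σ P
    -- The image of φ* on rational points is the set of P for which f(P) has a Galois-fixed preimage
    -- under λ*.
    · intro P
      constructor
      · rintro ⟨R, rfl⟩
        refine ⟨BrumerQuintic.twistStar ha hd hs (Point.baseChange ℚ (AlgebraicClosure k) R),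
          ?_, fun σ => ?_⟩
        · change BrumerQuintic.lamStar ha _ = BrumerQuintic.twist ha hd hs
            (Point.baseChange ℚ (AlgebraicClosure k) (BrumerQuintic.phiStar ha hd R))
          rw [← BrumerQuintic.twist_phiStar, BrumerQuintic.phiStar_map]
        · rw [hmap, ← BrumerQuintic.twistStar_map_of_fixed ha hd hs _ (hfixs σ),
            Point.map_baseChange]
      · rintro ⟨Q, hQ, hσ⟩
        obtain ⟨R, rfl⟩ := BrumerQuintic.twistStar_surjective ha hd hs Q
        have hR : BrumerQuintic.phiStar ha hd R = Point.baseChange ℚ (AlgebraicClosure k) P := by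
          apply BrumerQuintic.twist_injective ha hd hs
          rw [BrumerQuintic.twist_phiStar]
          exact hQ
        refine BrumerQuintic.exists_phiStar_eq ha hd hs hR fun σ hs' => ?_
        apply BrumerQuintic.twistStar_injective ha hd hs
        rw [BrumerQuintic.twistStar_map_of_fixed ha hd hs _ hs']
        -- Since k = ℚ(√d), an automorphism over ℚ that fixes √d is k-linear, so the invariance of Q
        -- applies to it.
        exact hσ (AlgEquiv.ofRingEquiv (f := σ.toRingEquiv)
          (BrumerQuintic.map_algebraMap_of_adjoin_eq_top hk hs'))
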